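/- Let $m\ge 0$, let $a_1,\dots,a_m$ be the annihilation operators on the Fock space $\mathcal F=\mathrm{Fock}(\mathbb C^m)$ (dimension $2^m$), let $c_{2k-1}=a_k+a_k^\dagger$ and $c_{2k}=i(a_k^\dagger-a_k)$ be the $2m$ Majorana operators, and let $\Lambda=\sum_{j=1}^{2m}c_j\otimes c_j$ on $\mathcal F\otimes\mathcal F$. For every real orthogonal matrix $R\in O(2m)$ there is a unitary $U_R$ on $\mathcal F$, unique up to a phase, with $U_Rc_jU_R^\dagger=\sum_iR_{ji}c_i$ for all $j$. Define the twirl $$\mathcal S(\rho)=\int_{O(2m)}(U_R\otimes U_R)\,\rho\,(U_R\otimes U_R)^\dagger\,dR$$ with respect to the Haar probability measure of $O(2m)$; the integral converges for every operator $\rho$ on $\mathcal F\otimes\mathcal F$. Let $|0\rangle$ be a normalized vacuum state of any set of annihilation operators $b_1,\dots,b_m$, that is, of linear combinations of the $c_j$ that satisfy $\{b_j,b_k^\dagger\}=\delta_{jk}I$, $\{b_j,b_k\}=0$, with $b_k|0\rangle=0$ for all $k$. Then the orthogonal projector onto the null space of $\Lambda$ is $$\Pi_{\Lambda=0}=\binom{2m}{m}\,\mathcal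 S(|0,0\rangle\langle 0,0|).$$ Moreover, the null space of $\Lambda$ is the linear span of the vectors $|\psi,\psi\rangle=|\psi\rangle\otimes|\psi\rangle$ with $\psi$ a pure fermionic Gaussian state, i.e. $|\psi\rangle\langle\psi|=2^{-m}\prod_{k=1}^m(I+i\lambda_k\tilde c_{2k-1}\tilde c_{2k})$ with $\lambda_k\in\{-1,1\}$ and $\tilde c=R^Tc$ for some $R\in SO(2m)$; and it is contained in the symmetric subspace of $\mathcal F\otimes\mathcal F$ (the vectors fixed by the swap). -/

import Mathlib

open scoped Matrix Kronecker

noncomputable section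

namespace Fermion

/-- Fock space of `m` fermionic modes. The basis vector indexed by `s : Finset (Fin m)` is the
occupation-number state in which exactly the modes in `s` are occupied. -/
abbrev Fock (m : ℕ) := EuclideanSpace ℂ (Finset (Fin m))

/-- Operators on the Fock space, as matrices in the occupation-number basis. -/
abbrev Op (m : ℕ) := Matrix (Finset (Fin m)) (Finset (Fin m)) ℂ

/-- The Hilbert space of two copies of the Fock space: the product basis is indexed by pairs. -/
abbrev Fock2 (m : ℕ) := EuclideanSpace ℂ (Finset (Fin m) × Finset (Fin m))

/-- Operators on two copies of the Fock space. -/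
abbrev Op2 (m : ℕ) :=
  Matrix (Finset (Fin m) × Finset (Fin m)) (Finset (Fin m) × Finset (Fin m)) ℂ

/-- The annihilation operator `a_k`: it sends the basis state `t` to
`(-1) ^ #{l ∈ t | l < k}` times the basis state `t \ {k}` if `k ∈ t`, and to `0` otherwise. -/
def annihilation {m : ℕ} (k : Fin m) : Op m :=
  Matrix.of fun s t =>
    if k ∈ t ∧ s = t.erase k then (-1 : ℂ) ^ (t.filter (fun l => l < k)).card else 0

/-- The index set of the `2m` Majorana operators: `(k, 0)` and `(k, 1)` stand for the
indices `2k - 1` and `2k` of mode `k`. -/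
abbrev MIdx (m : ℕ) := Fin m × Fin 2

/-- The Majorana operators `c_{2k-1} = a_k + a_k†` and `c_{2k} = i (a_k† - a_k)`. -/
def majorana {m : ℕ} (j : MIdx m) : Op m :=
  if j.2 = 0 then annihilation j.1 + (annihilation j.1)ᴴ
  else Complex.I • ((annihilation j.1)ᴴ - annihilation j.1)

/-- The operator `Λ = ∑ j, c_j ⊗ c_j`. -/
def Lam (m : ℕ) : Op2 m := ∑ j : MIdx m, majorana j ⊗ₖ majorana j

/-- The null space of `Λ`. -/
def nullSpace (m : ℕ) : Submodule ℂ (Fock2 m) := LinearMap.ker (Matrix.toEuclideanLin (Lam m))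

/-- The product vector `|ψ, ψ⟩`. -/
def double {m : ℕ} (ψ : Fock m) : Fock2 m := WithLp.toLp 2 fun p => ψ p.1 * ψ p.2

/-- The operator `|ψ⟩⟨ψ|`. -/
def ketbra {ι : Type*} (ψ : EuclideanSpace ℂ ι) : Matrix ι ι ℂ :=
  Matrix.of fun s t => ψ s * star (ψ t)

/-- The symmetric subspace: the vectors that are fixed by the swap of the two copies. -/
def symmetricSubspace (m : ℕ) : Submodule ℂ (Fock2 m) where
  carrier := {v | ∀ s t, v (t, s) = v (s, t)}
  add_mem' := fun {v w} hv hw s t => by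
    have h1 : v (t, s) = v (s, t) := hv s t
    have h2 : w (t, s) = w (s, t) := hw s t
    simp [h1, h2]
  zero_mem' := fun s t => by simp
  smul_mem' := fun c v hv s t => by
    have h1 : v (t, s) = v (s, t) := hv s t
    simp [h1]

/-- `ψ` is a pure fermionic Gaussian state:
`|ψ⟩⟨ψ| = 2⁻ᵐ ∏ k, (I + i λ_k c̃_{2k-1} c̃_{2k})` with `λ_k = ± 1` and `c̃ = Rᵀ c` for some
`R ∈ SO(2m)`. (The factors of the product commute.) -/
def IsPureGaussian {m : ℕ} (ψ : Fock m) : Prop :=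
  ∃ R ∈ Matrix.specialOrthogonalGroup (MIdx m) ℝ, ∃ lam : Fin m → ℝ,
    (∀ k, lam k = 1 ∨ lam k = -1) ∧
    ketbra ψ = (1 / 2 ^ m : ℂ) •
      (List.ofFn fun k : Fin m =>
        (1 : Op m) + (Complex.I * (lam k : ℂ)) •
          ((∑ i, (R i (k, 0) : ℂ) • majorana i) * (∑ i, (R i (k, 1) : ℂ) • majorana i))).prod

/-- `b` is a set of annihilation operators of the system: linear combinations of the Majorana
operators that satisfy the canonical anticommutation relations. -/
structure IsAnnihilationFamily {m : ℕ} (b : Fin m → Op m) : Prop where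
  linear : ∀ k, b k ∈ Submodule.span ℂ (Set.range (majorana (m := m)))
  anticomm_adjoint : ∀ j k, b j * (b k)ᴴ + (b k)ᴴ * b j = if j = k then 1 else 0
  anticomm : ∀ j k, b j * b k + b k * b j = 0

/-- `Ω` is a normalized vacuum state of the annihilation operators `b`. -/
def IsVacuum {m : ℕ} (b : Fin m → Op m) (Ω : Fock m) : Prop :=
  ‖Ω‖ = 1 ∧ ∀ k, Matrix.toEuclideanLin (b k) Ω = 0

/-- The group of real orthogonal `2m × 2m` matrices, with its Borel structure. -/
abbrev OGroup (m : ℕ) := Matrix.orthogonalGroup (MIdx m) ℝ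

instance (m : ℕ) : MeasurableSpace (OGroup m) := borel _

instance (m : ℕ) : BorelSpace (OGroup m) := ⟨rfl⟩

instance (m : ℕ) : CompactSpace (OGroup m) := by
  refine isCompact_iff_compactSpace.mp ?_
  have hK : IsCompact (Set.univ.pi fun _ : MIdx m =>
      Set.univ.pi fun _ : MIdx m => Set.Icc (-1 : ℝ) 1) :=
    isCompact_univ_pi fun _ => isCompact_univ_pi fun _ => isCompact_Icc
  refine hK.of_isClosed_subset (isClosed_unitary (R := Matrix (MIdx m) (MIdx m) ℝ)) ?_
  intro A hA i _ j _
  have h := entry_norm_bound_of_unitary (𝕜 := ℝ) hA i j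
  rw [Real.norm_eq_abs] at h
  exact abs_le.mp h

/-- The Haar probability measure on the orthogonal group. -/
def haarO (m : ℕ) : MeasureTheory.Measure (OGroup m) := MeasureTheory.Measure.haarMeasure ⊤

/-- The unitary `U` implements the linear transformation `R` of the Majorana operators:
`U c_j U† = ∑ i, R_{ji} c_i` for every `j`. -/
def Implements {m : ℕ} (U : Op m) (R : OGroup m) : Prop :=
  U ∈ Matrix.unitaryGroup (Finset (Fin m)) ℂ ∧
    ∀ j, U * majorana j * Uᴴ = ∑ i, ((R : Matrix (MIdx m) (MIdx m) ℝ) j i : ℂ) • majorana i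

open Classical in
/-- A unitary that implements `R` (it is unique up to a phase). -/
def floUnitary {m : ℕ} (R : OGroup m) : Op m :=
  if h : ∃ U : Op m, Implements U R then h.choose else 1

/-- The conjugation `(U ⊗ U) ρ (U ⊗ U)†` with the unitary `U` that implements `R`;
it does not depend on the phase of `U`. -/
def conjFLO {m : ℕ} (ρ : Op2 m) (R : OGroup m) : Op2 m :=
  (floUnitary R ⊗ₖ floUnitary R) * ρ * (floUnitary R ⊗ₖ floUnitary R)ᴴ

/-- The twirl `S(ρ) = ∫ (U ⊗ U) ρ (U ⊗ U)† dU`, an entrywise integral over the Haar probability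
measure of the real orthogonal matrices `R` that are implemented by `U`. -/
def twirl {m : ℕ} (ρ : Op2 m) : Op2 m :=
  Matrix.of fun p q => ∫ R, conjFLO ρ R p q ∂(haarO m)

end Fermion

end

/-!
The two-copy operators `Z_j = c_j ⊗ c_j` commute and square to `1`. The maximally entangled vector
`∑ s, |s, s⟩` is a joint eigenvector of them, because each `c_j` is symmetric or antisymmetric as a
matrix, and `(-1)^N c_j ⊗ 1` flips the sign of `Z_j` alone. Hence every sign pattern in
`{±1}^{2m}` occurs, and by a dimension count exactly once (`exists_eigenbasis`). The null space of
`Λ = ∑ j, Z_j` is therefore spanned by the `binom(2m, m)` eigenvectors `ξ_S` that have as many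
positive as negative signs, `S` being the `m`-element set of the negative ones.

Unitaries `U_R` exist by the Cartan–Dieudonné theorem, since `(-1)^N c_v` implements the reflection
orthogonal to `v` (`exists_implements`). They are unique up to a phase, since the `c_j` generate the
full matrix algebra (`adjoin_majorana`). For the same reason `A ↦ U_R A U_R†` depends continuously
on `R`, although the phase of `U_R` is chosen arbitrarily, so that the twirl converges
(`continuous_conj_floUnitary`). By invariance of the Haar measure, which on a compact group holds on
both sides, the twirl commutes with every `U_R ⊗ U_R` (`commute_twirl`).

The unitaries `U_R ⊗ U_R` act irreducibly on the null space (`exists_scalar_of_commute`). There the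
total parity is `1`, so a reflection of one coordinate acts as `Z_j`, and an operator that commutes
with all `Z_j` is diagonal in the basis `ξ_S`. Permutation matrices map the `ξ_S` to multiples of
one another, transitively, so all diagonal entries agree. Comparing traces, the twirl of any operator of
trace one that is supported on the null space is the projector divided by `binom(2m, m)`
(`toEuclideanCLM_twirl`).

A doubled vacuum lies in the null space because `Λ = 2 ∑ k, (b_k† ⊗ b_k + b_k ⊗ b_k†)`
(`IsAnnihilationFamily.Lam_eq`). A Gaussian projector is the image under some `U_R` of the projector
onto an occupation-number state (`gaussian_eq_ketbra`), so doubled Gaussian states lie in the null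
space as well. A vector of the null space that is orthogonal to all of them is annihilated by the
integrand of the twirl of `|0,0⟩⟨0,0|`, hence by the projector, and so it vanishes
(`span_double_gaussian`).
-/

noncomputable section

namespace Fermion

variable {m : ℕ}

/-! ### Majorana operators in the occupation-number basis -/

/-- The Jordan–Wigner sign `(-1) ^ #{l ∈ t | l < k}`, as a product. -/
def jwSign (k : Fin m) (t : Finset (Fin m)) : ℂ := ∏ l ∈ t, if l < k then -1 else 1

/-- The coefficient with which `c_j` maps the basis state `t` to the basis state `t ∆ {j.1}`. -/
def phase (j : MIdx m) (t : Finset (Fin m)) : ℂ :=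
  jwSign j.1 t * if j.2 = 0 then 1 else Complex.I * if j.1 ∈ t then -1 else 1

lemma jwSign_eq_pow (k : Fin m) (t : Finset (Fin m)) :
    jwSign k t = (-1) ^ (t.filter (fun l => l < k)).card := by
  rw [jwSign, Finset.prod_ite, Finset.prod_const, Finset.prod_const_one, mul_one]

lemma jwSign_mul_self (k : Fin m) (t : Finset (Fin m)) : jwSign k t * jwSign k t = 1 := by
  rw [jwSign_eq_pow, ← mul_pow]; simp

lemma star_jwSign (k : Fin m) (t : Finset (Fin m)) : star (jwSign k t) = jwSign k t := by
  rw [jwSign_eq_pow]; simp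

lemma symmDiff_singleton_of_mem {α : Type*} [DecidableEq α] {k : α} {t : Finset α} (h : k ∈ t) :
    symmDiff t {k} = t.erase k := by
  ext a; simp only [Finset.mem_symmDiff, Finset.mem_singleton, Finset.mem_erase]; grind

lemma symmDiff_singleton_of_notMem {α : Type*} [DecidableEq α] {k : α} {t : Finset α}
    (h : k ∉ t) : symmDiff t {k} = insert k t := by
  ext a; simp only [Finset.mem_symmDiff, Finset.mem_singleton, Finset.mem_insert]; grind

lemma symmDiff_singleton_twice {α : Type*} [DecidableEq α] (k : α) (t : Finset α) :
    symmDiff (symmDiff t {k}) {k} = t := symmDiff_symmDiff_cancel_right _ _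

lemma jwSign_symmDiff (k l : Fin m) (t : Finset (Fin m)) :
    jwSign k (symmDiff t {l}) = jwSign k t * if l < k then -1 else 1 := by
  by_cases h : l ∈ t
  · rw [symmDiff_singleton_of_mem h, jwSign, jwSign, ← Finset.mul_prod_erase t _ h]
    split_ifs <;> ring
  · rw [symmDiff_singleton_of_notMem h, jwSign, jwSign, Finset.prod_insert h, mul_comm]

lemma mem_symmDiff_singleton {α : Type*} [DecidableEq α] (k l : α) (t : Finset α) :
    (k ∈ symmDiff t {l}) ↔ (if k = l then k ∉ t else k ∈ t) := by
  simp only [Finset.mem_symmDiff, Finset.mem_singleton]; grind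

lemma annihilation_apply (k : Fin m) (s t : Finset (Fin m)) :
    annihilation k s t = if s = symmDiff t {k} ∧ k ∈ t then jwSign k t else 0 := by
  by_cases h : k ∈ t
  · simp [annihilation, jwSign_eq_pow, symmDiff_singleton_of_mem h, h]
  · simp [annihilation, h]

lemma annihilation_conjTranspose_apply (k : Fin m) (s t : Finset (Fin m)) :
    (annihilation k)ᴴ s t = if s = symmDiff t {k} ∧ k ∉ t then jwSign k t else 0 := by
  have key : (t = symmDiff s {k} ∧ k ∈ s) ↔ (s = symmDiff t {k} ∧ k ∉ t) := by
    constructor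
    · rintro ⟨rfl, h⟩
      simp [mem_symmDiff_singleton, h]
    · rintro ⟨rfl, h⟩
      simp [mem_symmDiff_singleton, h]
  rw [Matrix.conjTranspose_apply, annihilation_apply]
  simp only [key]
  split_ifs with h
  · rw [star_jwSign, h.1, jwSign_symmDiff]; simp
  · simp

/-- Each Majorana operator is a monomial matrix: it toggles the occupation of its mode. -/
lemma majorana_apply (j : MIdx m) (s t : Finset (Fin m)) :
    majorana j s t = if s = symmDiff t {j.1} then phase j t else 0 := by
  unfold majorana phase
  by_cases h0 : j.2 = 0 <;> by_cases hs : s = symmDiff t {j.1} <;> by_cases hm : j.1 ∈ t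
  all_goals
    simp only [h0, ↓reduceIte, Matrix.add_apply, Matrix.sub_apply, Matrix.smul_apply,
      annihilation_apply, annihilation_conjTranspose_apply]
    simp [hs, hm, mul_comm]

/-- Toggling the mode `l` changes the sign of the coefficient of `c_i` if `l` comes before the mode
of `i`, or if `i = (l, 1)`. For two indices of distinct modes exactly one of the two coefficients
changes, which is the source of the anticommutation relations. -/
lemma phase_symmDiff (i : MIdx m) (l : Fin m) (t : Finset (Fin m)) :
    phase i (symmDiff t {l}) =
      phase i t * (if l < i.1 then -1 else 1) * if i.2 = 1 ∧ i.1 = l then -1 else 1 := by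
  have h2 : i.2 = 0 ∨ i.2 = 1 := by omega
  rcases h2 with h2 | h2 <;> by_cases hl : i.1 = l <;> by_cases ht : i.1 ∈ t <;>
    by_cases hlt : l < i.1 <;>
    simp [phase, jwSign_symmDiff, h2, hl, ht, hlt, mem_symmDiff_singleton] <;> simp_all

lemma phase_mul_phase_symmDiff (j : MIdx m) (t : Finset (Fin m)) :
    phase j (symmDiff t {j.1}) * phase j t = 1 := by
  have h2 : j.2 = 0 ∨ j.2 = 1 := by omega
  have hs := jwSign_mul_self j.1 t
  rw [phase_symmDiff]
  rcases h2 with h2 | h2 <;> by_cases ht : j.1 ∈ t <;> simp [phase, h2, ht] <;>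
    first
    | linear_combination hs
    | linear_combination hs - jwSign j.1 t * jwSign j.1 t * Complex.I_sq

lemma star_phase (j : MIdx m) (t : Finset (Fin m)) :
    star (phase j t) = phase j (symmDiff t {j.1}) := by
  have h2 : j.2 = 0 ∨ j.2 = 1 := by omega
  have hs := star_jwSign j.1 t
  rw [phase_symmDiff]
  rcases h2 with h2 | h2 <;> by_cases ht : j.1 ∈ t <;> simp_all [phase]

lemma majorana_mul_apply (i j : MIdx m) (s t : Finset (Fin m)) :
    (majorana i * majorana j) s t =
      if s = symmDiff (symmDiff t {j.1}) {i.1} then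
        phase i (symmDiff t {j.1}) * phase j t else 0 := by
  rw [Matrix.mul_apply, Finset.sum_eq_single (symmDiff t {j.1})]
  · simp [majorana_apply]
  · intro u _ hu; simp [majorana_apply, hu]
  · simp

/-- The Majorana operators are self-adjoint. -/
lemma majorana_conjTranspose (j : MIdx m) : (majorana j)ᴴ = majorana j := by
  ext s t
  rw [Matrix.conjTranspose_apply, majorana_apply, majorana_apply]
  by_cases h : s = symmDiff t {j.1}
  · subst h
    simp [star_phase]
  · have h' : t ≠ symmDiff s {j.1} := by
      rintro rfl; exact h (symmDiff_singleton_twice _ _).symm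
    simp [h, h']

lemma majorana_mul_self (j : MIdx m) : majorana j * majorana j = 1 := by
  ext s t
  rw [majorana_mul_apply, symmDiff_singleton_twice, phase_mul_phase_symmDiff, Matrix.one_apply]

lemma majorana_mul_of_ne {i j : MIdx m} (h : i ≠ j) :
    majorana i * majorana j = -(majorana j * majorana i) := by
  ext s t
  rw [Matrix.neg_apply, majorana_mul_apply, majorana_mul_apply,
    symmDiff_right_comm t {i.1} {j.1}]
  split_ifs
  · have hi : i.2 = 0 ∨ i.2 = 1 := by omega
    have hj : j.2 = 0 ∨ j.2 = 1 := by omega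
    rw [phase_symmDiff, phase_symmDiff]
    rcases lt_trichotomy i.1 j.1 with hlt | heq | hgt
    · simp [hlt, hlt.ne, hlt.ne', hlt.not_gt]; ring
    · have h2 : i.2 ≠ j.2 := fun h2 => h (Prod.ext heq h2)
      rcases hi with hi | hi <;> rcases hj with hj | hj <;> simp_all <;> ring
    · simp [hgt, hgt.ne, hgt.ne', hgt.not_gt]; ring
  · simp

/-- The Clifford relations. -/
lemma majorana_anticomm (i j : MIdx m) :
    majorana i * majorana j + majorana j * majorana i = if i = j then 2 else 0 := by
  split_ifs with h
  · subst h; rw [majorana_mul_self]; exact one_add_one_eq_two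
  · rw [majorana_mul_of_ne h]; simp

/-- The fermion parity operator. -/
def parity (m : ℕ) : Op m := Matrix.diagonal fun s => (-1) ^ s.card

lemma parity_mul_self : parity m * parity m = 1 := by
  simp [parity, ← mul_pow]

lemma parity_conjTranspose : (parity m)ᴴ = parity m := by
  rw [parity, Matrix.diagonal_conjTranspose]; congr 1; ext s; simp

lemma parity_mul_majorana (j : MIdx m) : parity m * majorana j = -(majorana j * parity m) := by
  ext s t
  rw [Matrix.neg_apply, parity, Matrix.diagonal_mul, Matrix.mul_diagonal, majorana_apply]
  split_ifs with h
  · subst h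
    by_cases ht : j.1 ∈ t
    · rw [symmDiff_singleton_of_mem ht, ← Finset.card_erase_add_one ht]; ring
    · rw [symmDiff_singleton_of_notMem ht, Finset.card_insert_of_notMem ht]; ring
  · simp

/-- The linear combination `∑ j, v_j c_j`. -/
def cliff (v : MIdx m → ℂ) : Op m := ∑ j, v j • majorana j

lemma cliff_single (j : MIdx m) : cliff (Pi.single j 1) = majorana j := by
  simp [cliff, Pi.single_apply]

lemma cliff_anticomm (v w : MIdx m → ℂ) :
    cliff v * cliff w + cliff w * cliff v = (2 * ∑ j, v j * w j) • (1 : Op m) := by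
  have h : cliff v * cliff w + cliff w * cliff v =
      ∑ i, ∑ j, (v i * w j) • (majorana i * majorana j + majorana j * majorana i) := by
    simp only [cliff, Finset.sum_mul_sum, smul_add, Finset.sum_add_distrib, smul_mul_smul_comm]
    congr 1
    rw [Finset.sum_comm]
    simp only [mul_comm]
  rw [h]
  simp only [majorana_anticomm, smul_ite, smul_zero, Finset.sum_ite_eq, Finset.mem_univ, if_true]
  rw [Finset.mul_sum, Finset.sum_smul]
  refine Finset.sum_congr rfl fun i _ => ?_
  rw [← one_add_one_eq_two, smul_add, ← add_smul]
  congr 1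
  ring

lemma cliff_conjTranspose (v : MIdx m → ℂ) : (cliff v)ᴴ = cliff (fun j => star (v j)) := by
  simp [cliff, Matrix.conjTranspose_sum, majorana_conjTranspose]

lemma cliff_kronecker_cliff (v w : MIdx m → ℂ) :
    cliff v ⊗ₖ cliff w = ∑ i, ∑ l, (v i * w l) • (majorana i ⊗ₖ majorana l) := by
  ext p q
  simp only [cliff, Matrix.kroneckerMap_apply, Matrix.sum_apply, Matrix.smul_apply, smul_eq_mul,
    Finset.sum_mul_sum]
  refine Finset.sum_congr rfl fun i _ => Finset.sum_congr rfl fun l _ => ?_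
  ring

lemma parity_mul_cliff (v : MIdx m → ℂ) : parity m * cliff v = -(cliff v * parity m) := by
  simp [cliff, Finset.mul_sum, Finset.sum_mul, parity_mul_majorana]

lemma number_eq (k : Fin m) :
    (annihilation k)ᴴ * annihilation k = Matrix.diagonal fun s => if k ∈ s then 1 else 0 := by
  ext s t
  rw [Matrix.mul_apply, Finset.sum_eq_single (symmDiff t {k})]
  · rw [annihilation_conjTranspose_apply, annihilation_apply, symmDiff_singleton_twice,
      Matrix.diagonal_apply, jwSign_symmDiff]
    by_cases h : k ∈ t <;> by_cases hs : s = t <;>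
      simp [h, hs, mem_symmDiff_singleton, jwSign_mul_self]
  · intro u _ hu; simp [annihilation_apply, hu]
  · simp

lemma annihilation_eq (k : Fin m) :
    annihilation k = (1 / 2 : ℂ) • (majorana (k, 0) + Complex.I • majorana (k, 1)) := by
  simp only [majorana, Fin.isValue, ↓reduceIte, one_ne_zero, smul_smul, Complex.I_mul_I]
  module

lemma annihilation_conjTranspose_eq (k : Fin m) :
    (annihilation k)ᴴ = (1 / 2 : ℂ) • (majorana (k, 0) - Complex.I • majorana (k, 1)) := by
  simp only [majorana, Fin.isValue, ↓reduceIte, one_ne_zero, smul_smul, Complex.I_mul_I]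
  module

/-- The Majorana operators generate the full matrix algebra: the number operators yield all
diagonal matrix units, and cutting a creation operator with these yields the other ones. -/
lemma adjoin_majorana : Algebra.adjoin ℂ (Set.range (majorana (m := m))) = ⊤ := by
  set A := Algebra.adjoin ℂ (Set.range (majorana (m := m))) with hA
  have hc (j : MIdx m) : majorana j ∈ A := Algebra.subset_adjoin ⟨j, rfl⟩
  have ha (k : Fin m) : annihilation k ∈ A := by
    rw [annihilation_eq]
    exact A.smul_mem (A.add_mem (hc _) (A.smul_mem (hc _) _)) _
  have had (k : Fin m) : (annihilation k)ᴴ ∈ A := by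
    rw [annihilation_conjTranspose_eq]
    exact A.smul_mem (A.sub_mem (hc _) (A.smul_mem (hc _) _)) _
  have hunit (s : Finset (Fin m)) : Matrix.single s s (1 : ℂ) ∈ A := by
    let D : Subalgebra ℂ (Finset (Fin m) → ℂ) := A.comap (Matrix.diagonalAlgHom ℂ)
    let e (k : Fin m) : Finset (Fin m) → ℂ := fun s => if k ∈ s then 1 else 0
    have he (k : Fin m) : e k ∈ D := by
      change Matrix.diagonal (e k) ∈ A
      rw [← number_eq]
      exact A.mul_mem (had k) (ha k)
    -- the indicator function of `s` is a product of the functions `k ∈ ·` and `k ∉ ·`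
    have hs : Pi.single s 1 = ∏ k, if k ∈ s then e k else 1 - e k := by
      ext t
      rw [Finset.prod_apply]
      by_cases hst : t = s
      · subst hst
        rw [Pi.single_eq_same]
        refine (Finset.prod_eq_one fun k _ => ?_).symm
        by_cases hk : k ∈ t <;> simp [e, hk]
      · rw [Pi.single_eq_of_ne hst]
        obtain ⟨k, hk⟩ : ∃ k, ¬ (k ∈ t ↔ k ∈ s) := by
          by_contra! h; exact hst (Finset.ext h)
        refine (Finset.prod_eq_zero (Finset.mem_univ k) ?_).symm
        by_cases hks : k ∈ s <;> by_cases hkt : k ∈ t <;> simp_all [e]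
    have : Pi.single s 1 ∈ D := by
      rw [hs]
      refine D.prod_mem fun k _ => ?_
      split_ifs
      exacts [he k, D.sub_mem D.one_mem (he k)]
    rw [← Matrix.diagonal_single]
    exact this
  have hstep (s : Finset (Fin m)) :
      Matrix.single s ∅ (1 : ℂ) ∈ A ∧ Matrix.single ∅ s (1 : ℂ) ∈ A := by
    induction s using Finset.induction with
    | empty => exact ⟨hunit ∅, hunit ∅⟩
    | insert k s hk ih =>
      have hne : jwSign k s ≠ 0 := left_ne_zero_of_mul_eq_one (jwSign_mul_self k s)
      have hu : symmDiff s {k} = insert k s := symmDiff_singleton_of_notMem hk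
      have hd : symmDiff (insert k s) {k} = s := by rw [← hu, symmDiff_singleton_twice]
      have h1 : (annihilation k)ᴴ (insert k s) s = jwSign k s := by
        rw [annihilation_conjTranspose_apply, hu]; simp [hk]
      have h2 : annihilation k s (insert k s) = jwSign k s := by
        rw [annihilation_apply, hd, ← hu, jwSign_symmDiff]; simp [hk, mem_symmDiff_singleton]
      have e1 : Matrix.single (insert k s) s (1 : ℂ) = (jwSign k s)⁻¹ •
          (Matrix.single (insert k s) (insert k s) (1 : ℂ) * (annihilation k)ᴴ *
            Matrix.single s s (1 : ℂ)) := by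
        rw [Matrix.single_mul_mul_single, h1]
        simp [hne]
      have e2 : Matrix.single s (insert k s) (1 : ℂ) = (jwSign k s)⁻¹ •
          (Matrix.single s s (1 : ℂ) * annihilation k *
            Matrix.single (insert k s) (insert k s) (1 : ℂ)) := by
        rw [Matrix.single_mul_mul_single, h2]
        simp [hne]
      have m1 : Matrix.single (insert k s) s (1 : ℂ) ∈ A := by
        rw [e1]; exact A.smul_mem (A.mul_mem (A.mul_mem (hunit _) (had k)) (hunit _)) _
      have m2 : Matrix.single s (insert k s) (1 : ℂ) ∈ A := by
        rw [e2]; exact A.smul_mem (A.mul_mem (A.mul_mem (hunit _) (ha k)) (hunit _)) _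
      have p1 := A.mul_mem m1 ih.1
      have p2 := A.mul_mem ih.2 m2
      rw [Matrix.single_mul_single_same, mul_one] at p1 p2
      exact ⟨p1, p2⟩
  refine eq_top_iff.mpr fun M _ => ?_
  rw [Matrix.matrix_eq_sum_single M]
  refine A.sum_mem fun s _ => A.sum_mem fun t _ => ?_
  have : Matrix.single s t (M s t) =
      M s t • (Matrix.single s ∅ (1 : ℂ) * Matrix.single ∅ t (1 : ℂ)) := by
    rw [Matrix.single_mul_single_same]; simp
  rw [this]
  exact A.smul_mem (A.mul_mem (hstep s).1 (hstep t).2) _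

/-! ### Unitaries that implement orthogonal transformations -/

lemma cliff_mul_self {v : MIdx m → ℂ} (hv : ∑ j, v j * v j = 1) : cliff v * cliff v = 1 := by
  have h := cliff_anticomm v v
  rw [hv, ← two_smul ℂ (cliff v * cliff v), mul_one] at h
  exact smul_right_injective _ (two_ne_zero (α := ℂ)) h

/-- The unitary `(-1)^N c_v` implements the reflection in the hyperplane orthogonal to the
unit vector `v`. -/
lemma implements_reflection {v : MIdx m → ℝ} (hv : ∑ j, v j * v j = 1) {R : OGroup m}
    (hR : ∀ i j, (R : Matrix (MIdx m) (MIdx m) ℝ) i j = (if i = j then 1 else 0) - 2 * v i * v j) :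
    Implements (parity m * cliff (fun j => (v j : ℂ))) R := by
  set w : MIdx m → ℂ := fun j => (v j : ℂ) with hw
  have hw1 : ∑ j, w j * w j = 1 := by
    simp only [hw]; exact_mod_cast hv
  have hsq := cliff_mul_self hw1
  have hH : (cliff w)ᴴ = cliff w := by
    rw [cliff_conjTranspose]; simp [hw]
  have hUH : (parity m * cliff w)ᴴ = cliff w * parity m := by
    rw [Matrix.conjTranspose_mul, hH, parity_conjTranspose]
  refine ⟨?_, fun j => ?_⟩
  · rw [Matrix.mem_unitaryGroup_iff, Matrix.star_eq_conjTranspose, hUH, mul_assoc,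
      ← mul_assoc (cliff w), hsq, one_mul, parity_mul_self]
  · have h1 : cliff w * majorana j = (2 * w j) • 1 - majorana j * cliff w := by
      have := cliff_anticomm w (Pi.single j 1)
      rw [cliff_single] at this
      rw [eq_sub_iff_add_eq, this]
      simp [Pi.single_apply]
    have h2 : cliff w * majorana j * cliff w = (2 * w j) • cliff w - majorana j := by
      rw [h1, sub_mul, mul_assoc, hsq]; simp
    have h3 : ∑ i, (((R : Matrix (MIdx m) (MIdx m) ℝ) j i : ℝ) : ℂ) • majorana i =
        majorana j - (2 * w j) • cliff w := by
      have : ∀ i, (((R : Matrix (MIdx m) (MIdx m) ℝ) j i : ℝ) : ℂ) • (majorana i : Op m) =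
          (if j = i then majorana i else 0) - (2 * w j) • w i • majorana i := by
        intro i
        rw [hR]
        split_ifs <;> simp [hw, sub_smul, mul_smul]
      simp only [this, Finset.sum_sub_distrib, ← Finset.smul_sum]
      simp [cliff]
    calc parity m * cliff w * majorana j * (parity m * cliff w)ᴴ
        = parity m * (cliff w * majorana j * cliff w) * parity m := by
          rw [hUH]; simp only [mul_assoc]
      _ = _ := by
          rw [h2, h3, mul_sub, sub_mul, mul_smul_comm, parity_mul_cliff, parity_mul_majorana]
          simp only [smul_mul_assoc, neg_mul, mul_assoc, parity_mul_self, mul_one]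
          module

lemma Implements.conjTranspose_mul_self {U : Op m} {R : OGroup m} (h : Implements U R) :
    Uᴴ * U = 1 := Matrix.mem_unitaryGroup_iff'.mp h.1

lemma Implements.mul_conjTranspose_self {U : Op m} {R : OGroup m} (h : Implements U R) :
    U * Uᴴ = 1 := Matrix.mem_unitaryGroup_iff.mp h.1

lemma implements_one : Implements (1 : Op m) 1 := by
  refine ⟨one_mem _, fun j => ?_⟩
  simp [Matrix.one_apply, ite_smul]

/-- Composition of implementing unitaries reverses the order of the orthogonal matrices. -/
lemma Implements.mul {U V : Op m} {R S : OGroup m} (hU : Implements U R) (hV : Implements V S) :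
    Implements (U * V) (S * R) := by
  refine ⟨mul_mem hU.1 hV.1, fun j => ?_⟩
  have : U * V * majorana j * (U * V)ᴴ = U * (V * majorana j * Vᴴ) * Uᴴ := by
    rw [Matrix.conjTranspose_mul]; simp only [mul_assoc]
  rw [this, hV.2, Finset.mul_sum, Finset.sum_mul]
  simp only [mul_smul_comm, smul_mul_assoc, hU.2, Finset.smul_sum]
  rw [Finset.sum_comm]
  refine Finset.sum_congr rfl fun i _ => ?_
  simp [Matrix.mul_apply, Finset.sum_smul, mul_smul]

/-- An operator that commutes with all Majorana operators is a scalar. -/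
lemma exists_smul_one_of_commute_majorana {A : Op m}
    (h : ∀ j, A * majorana j = majorana j * A) : ∃ z : ℂ, A = z • 1 := by
  have hle : Algebra.adjoin ℂ (Set.range (majorana (m := m))) ≤ Subalgebra.centralizer ℂ {A} := by
    refine Algebra.adjoin_le ?_
    rintro _ ⟨j, rfl⟩
    rw [SetLike.mem_coe, Subalgebra.mem_centralizer_iff]
    rintro _ rfl
    exact h j
  have hA (B : Op m) : A * B = B * A := by
    have hB : B ∈ Subalgebra.centralizer ℂ {A} := hle (adjoin_majorana ▸ Algebra.mem_top)
    exact (Subalgebra.mem_centralizer_iff ℂ).mp hB A rfl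
  obtain ⟨z, hz⟩ := Matrix.mem_range_scalar_of_commute_single (M := A)
    fun i j _ => (hA (Matrix.single i j 1)).symm
  refine ⟨z, ?_⟩
  rw [← hz, Matrix.scalar_apply, Matrix.smul_one_eq_diagonal]

lemma Implements.unique {U V : Op m} {R : OGroup m} (hU : Implements U R) (hV : Implements V R) :
    ∃ z : ℂ, ‖z‖ = 1 ∧ V = z • U := by
  have hcomm (j : MIdx m) : Uᴴ * V * majorana j = majorana j * (Uᴴ * V) := by
    have h1 : V * majorana j = U * majorana j * Uᴴ * V := by
      rw [hU.2, ← hV.2, mul_assoc, hV.conjTranspose_mul_self, mul_one]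
    rw [mul_assoc, h1]
    simp only [← mul_assoc, hU.conjTranspose_mul_self, one_mul]
  obtain ⟨z, hz⟩ := exists_smul_one_of_commute_majorana hcomm
  have hVU : V = z • U := by
    have : U * (Uᴴ * V) = V := by rw [← mul_assoc, hU.mul_conjTranspose_self, one_mul]
    rw [← this, hz]; simp
  refine ⟨z, ?_, hVU⟩
  have h1 := hV.mul_conjTranspose_self
  rw [hVU, Matrix.conjTranspose_smul, smul_mul_smul_comm, hU.mul_conjTranspose_self] at h1
  have h2 := congrFun (congrFun h1 ∅) ∅
  simp only [Matrix.smul_apply, Matrix.one_apply_eq, smul_eq_mul, mul_one] at h2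
  have h3 : ‖z‖ * ‖z‖ = 1 := by simpa using congrArg norm h2
  nlinarith [norm_nonneg z]

/-- Orthogonal matrices are the same as linear isometries of Euclidean space. -/
def orthogonalEquiv (m : ℕ) :
    OGroup m ≃* (EuclideanSpace ℝ (MIdx m) ≃ₗᵢ[ℝ] EuclideanSpace ℝ (MIdx m)) :=
  (Unitary.mapEquiv
    { MulEquivClass.toMulEquiv (Matrix.toEuclideanCLM (n := MIdx m) (𝕜 := ℝ)) with
      map_star' := map_star (Matrix.toEuclideanCLM (n := MIdx m) (𝕜 := ℝ)) }).toMulEquiv.trans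
    Unitary.linearIsometryEquiv

lemma orthogonalEquiv_apply (R : OGroup m) (i j : MIdx m) :
    (R : Matrix (MIdx m) (MIdx m) ℝ) i j =
      orthogonalEquiv m R (EuclideanSpace.single j 1) i := by
  change _ = ((R : Matrix (MIdx m) (MIdx m) ℝ) *ᵥ Pi.single j 1) i
  simp

/-- Every orthogonal transformation of the Majorana operators is implemented by a unitary: by the
Cartan–Dieudonné theorem it suffices to treat reflections. -/
lemma exists_implements (R : OGroup m) : ∃ U : Op m, Implements U R := by
  obtain ⟨l, -, hl⟩ := (orthogonalEquiv m R).reflections_generate_dim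
  have hR : R = (orthogonalEquiv m).symm (l.map fun v => (ℝ ∙ v)ᗮ.reflection).prod := by
    rw [← hl, MulEquiv.symm_apply_apply]
  rw [hR]
  clear hl hR
  induction l with
  | nil => exact ⟨1, by simpa using implements_one⟩
  | cons v l ih =>
    obtain ⟨V, hV⟩ := ih
    rw [List.map_cons, List.prod_cons, map_mul]
    suffices h : ∃ U, Implements U ((orthogonalEquiv m).symm (ℝ ∙ v)ᗮ.reflection) by
      obtain ⟨U, hU⟩ := h
      exact ⟨V * U, hV.mul hU⟩
    -- the list may contain `0`, whose “reflection” is the identity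
    by_cases hv : v = 0
    · subst hv
      have h1 : (ℝ ∙ (0 : EuclideanSpace ℝ (MIdx m)))ᗮ.reflection = 1 := by
        ext x : 1
        rw [Submodule.reflection_orthogonal_apply, Submodule.reflection_singleton_apply]
        simp
      exact ⟨1, by rw [h1, map_one]; exact implements_one⟩
    · have hn : ‖v‖ ≠ 0 := norm_ne_zero_iff.mpr hv
      have hn2 : ∑ j, v j * v j = ‖v‖ ^ 2 := by
        rw [EuclideanSpace.real_norm_sq_eq]; simp only [sq]
      refine ⟨_, implements_reflection (v := fun j => v j / ‖v‖) ?_ fun i j => ?_⟩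
      · simp only [div_mul_div_comm, ← Finset.sum_div, hn2]
        field_simp
      · rw [orthogonalEquiv_apply, MulEquiv.apply_symm_apply,
          Submodule.reflection_orthogonal_apply, Submodule.reflection_singleton_apply]
        simp [EuclideanSpace.inner_single_right]
        field_simp

/-! ### The twirl -/

lemma implements_floUnitary (R : OGroup m) : Implements (floUnitary R) R := by
  rw [floUnitary, dif_pos (exists_implements R)]
  exact (exists_implements R).choose_spec

/-- The two-copy conjugation can be computed with any unitary that implements `R`. -/
lemma conjFLO_eq {U : Op m} {R : OGroup m} (hU : Implements U R) (ρ : Op2 m) :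
    conjFLO ρ R = (U ⊗ₖ U) * ρ * (U ⊗ₖ U)ᴴ := by
  obtain ⟨z, hz, h⟩ := hU.unique (implements_floUnitary R)
  have hzz : z * star z = 1 := by
    rw [Complex.star_def, Complex.mul_conj, Complex.normSq_eq_norm_sq, hz]; simp
  have hz4 : z * z * (star z * star z) = 1 := by
    rw [mul_mul_mul_comm, hzz, one_mul]
  rw [conjFLO, h, Matrix.smul_kronecker, Matrix.kronecker_smul, smul_smul,
    Matrix.conjTranspose_smul, smul_mul_assoc, smul_mul_assoc, mul_smul_comm, smul_smul, star_mul',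
    hz4, one_smul]

lemma conjFLO_kronecker (A B : Op m) (R : OGroup m) :
    conjFLO (A ⊗ₖ B) R = (floUnitary R * A * (floUnitary R)ᴴ) ⊗ₖ
      (floUnitary R * B * (floUnitary R)ᴴ) := by
  rw [conjFLO, Matrix.conjTranspose_kronecker, Matrix.mul_kronecker_mul, Matrix.mul_kronecker_mul]

/-- Although `floUnitary` is an arbitrary choice of phases, conjugation with it is continuous: it
is a homomorphism of algebras that maps the generators `c_j` to linear functions of `R`. -/
lemma continuous_conj_floUnitary (A : Op m) :
    Continuous fun R : OGroup m => floUnitary R * A * (floUnitary R)ᴴ := by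
  have hA : A ∈ Algebra.adjoin ℂ (Set.range (majorana (m := m))) :=
    adjoin_majorana ▸ Algebra.mem_top
  induction hA using Algebra.adjoin_induction with
  | mem x hx =>
    obtain ⟨j, rfl⟩ := hx
    simp only [(implements_floUnitary _).2]
    have h (i : MIdx m) : Continuous fun R : OGroup m => (R : Matrix (MIdx m) (MIdx m) ℝ) j i :=
      continuous_subtype_val.matrix_elem j i
    exact continuous_finsetSum _ fun i _ =>
      (Complex.continuous_ofReal.comp (h i)).smul continuous_const
  | algebraMap r =>
    simp only [Algebra.algebraMap_eq_smul_one, mul_smul_comm, smul_mul_assoc, mul_one,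
      (implements_floUnitary _).mul_conjTranspose_self]
    exact continuous_const
  | add x y _ _ hx hy =>
    simp only [mul_add, add_mul]
    exact hx.add hy
  | mul x y _ _ hx hy =>
    refine (hx.mul hy).congr fun R => ?_
    calc floUnitary R * x * (floUnitary R)ᴴ * (floUnitary R * y * (floUnitary R)ᴴ)
        = floUnitary R * x * ((floUnitary R)ᴴ * floUnitary R) * y * (floUnitary R)ᴴ := by
          simp only [mul_assoc]
      _ = _ := by
          rw [(implements_floUnitary R).conjTranspose_mul_self, mul_one, mul_assoc _ x y]

lemma continuous_conjFLO (ρ : Op2 m) : Continuous (conjFLO ρ) := by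
  have h (p q : Finset (Fin m) × Finset (Fin m)) (z : ℂ) :
      Continuous (conjFLO (Matrix.single p q z)) := by
    have : Matrix.single p q z = Matrix.single p.1 q.1 z ⊗ₖ Matrix.single p.2 q.2 1 := by
      rw [Matrix.single_kronecker_single, mul_one]
    simp only [funext (conjFLO_kronecker _ _), this]
    refine continuous_matrix fun i j => ?_
    exact ((continuous_conj_floUnitary _).matrix_elem _ _).mul
      ((continuous_conj_floUnitary _).matrix_elem _ _)
  have hsum : conjFLO ρ = fun R => ∑ p, ∑ q, conjFLO (Matrix.single p q (ρ p q)) R := by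
    funext R
    conv_lhs => rw [Matrix.matrix_eq_sum_single ρ]
    simp only [conjFLO, Finset.mul_sum, Finset.sum_mul]
  rw [hsum]
  exact continuous_finsetSum _ fun p _ => continuous_finsetSum _ fun q _ => h p q _

instance : MeasureTheory.Measure.IsHaarMeasure (haarO m) :=
  MeasureTheory.Measure.isHaarMeasure_haarMeasure _

instance : MeasureTheory.IsProbabilityMeasure (haarO m) :=
  ⟨MeasureTheory.Measure.haarMeasure_self⟩

/-- Right translates of the Haar measure are Haar probability measures, and these are unique. -/
instance : (haarO m).IsMulRightInvariant := by
  refine ⟨fun g => ?_⟩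
  have h1 : MeasureTheory.IsProbabilityMeasure ((haarO m).map (· * g)) :=
    MeasureTheory.Measure.isProbabilityMeasure_map (by fun_prop)
  have h2 : ((haarO m).map (· * g)).IsHaarMeasure :=
    MeasureTheory.Measure.isHaarMeasure_map_smul (haarO m) (MulOpposite.op g)
  exact MeasureTheory.Measure.isHaarMeasure_eq_of_isProbabilityMeasure _ _

lemma integrable_conjFLO (ρ : Op2 m) (p q : Finset (Fin m) × Finset (Fin m)) :
    MeasureTheory.Integrable (fun R => conjFLO ρ R p q) (haarO m) :=
  ((continuous_conjFLO ρ).matrix_elem p q).integrable_of_hasCompactSupport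
    (HasCompactSupport.of_compactSpace _)

/-- Linear functionals can be taken inside the integral that defines the twirl. -/
lemma map_twirl (L : Op2 m →ₗ[ℂ] ℂ) (ρ : Op2 m) :
    L (twirl ρ) = ∫ R, L (conjFLO ρ R) ∂(haarO m) := by
  have hL (M : Op2 m) : L M = ∑ p, ∑ q, M p q * L (Matrix.single p q 1) := by
    conv_lhs => rw [Matrix.matrix_eq_sum_single M]
    rw [map_sum]
    refine Finset.sum_congr rfl fun p _ => ?_
    rw [map_sum]
    refine Finset.sum_congr rfl fun q _ => ?_
    rw [← smul_eq_mul, ← map_smul, Matrix.smul_single, smul_eq_mul, mul_one]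
  simp only [hL (conjFLO ρ _)]
  rw [hL, MeasureTheory.integral_finsetSum _ fun p _ => MeasureTheory.integrable_finsetSum _
    fun q _ => (integrable_conjFLO ρ p q).mul_const _]
  refine Finset.sum_congr rfl fun p _ => ?_
  rw [MeasureTheory.integral_finsetSum _ fun q _ => (integrable_conjFLO ρ p q).mul_const _]
  refine Finset.sum_congr rfl fun q _ => ?_
  rw [MeasureTheory.integral_mul_const, twirl, Matrix.of_apply]

/-- The linear functional that maps `M` to the matrix entry `(A M B)_{pq}`. -/
def entryFunctional (A B : Op2 m) (p q : Finset (Fin m) × Finset (Fin m)) : Op2 m →ₗ[ℂ] ℂ :=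
  Matrix.entryLinearMap ℂ ℂ p q ∘ₗ LinearMap.mulLeft ℂ A ∘ₗ LinearMap.mulRight ℂ B

lemma mul_twirl_mul_apply (A B ρ : Op2 m) (p q : Finset (Fin m) × Finset (Fin m)) :
    (A * twirl ρ * B) p q = ∫ R, (A * conjFLO ρ R * B) p q ∂(haarO m) := by
  simpa [entryFunctional, mul_assoc] using map_twirl (entryFunctional A B p q) ρ

/-- The twirl of any operator commutes with the two-copy unitaries. -/
lemma commute_twirl {V : Op m} {S : OGroup m} (hV : Implements V S) (ρ : Op2 m) :
    (V ⊗ₖ V) * twirl ρ = twirl ρ * (V ⊗ₖ V) := by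
  have hVV : (V ⊗ₖ V)ᴴ * (V ⊗ₖ V) = 1 := by
    rw [Matrix.conjTranspose_kronecker, ← Matrix.mul_kronecker_mul, hV.conjTranspose_mul_self,
      Matrix.one_kronecker_one]
  have h : (V ⊗ₖ V) * twirl ρ * (V ⊗ₖ V)ᴴ = twirl ρ := by
    ext p q
    have h1 (R : OGroup m) : (V ⊗ₖ V) * conjFLO ρ R * (V ⊗ₖ V)ᴴ = conjFLO ρ (R * S) := by
      rw [conjFLO_eq (hV.mul (implements_floUnitary R)), Matrix.mul_kronecker_mul,
        Matrix.conjTranspose_mul, conjFLO]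
      simp only [mul_assoc]
    -- composition of the unitaries reverses the matrices, so right invariance is what is needed
    rw [mul_twirl_mul_apply]
    simp only [h1]
    rw [MeasureTheory.integral_mul_right_eq_self (fun R => conjFLO ρ R p q) S, twirl,
      Matrix.of_apply]
  calc (V ⊗ₖ V) * twirl ρ = (V ⊗ₖ V) * twirl ρ * ((V ⊗ₖ V)ᴴ * (V ⊗ₖ V)) := by rw [hVV, mul_one]
    _ = _ := by rw [← mul_assoc, h]

lemma trace_twirl (ρ : Op2 m) : (twirl ρ).trace = ρ.trace := by
  have h (R : OGroup m) : (conjFLO ρ R).trace = ρ.trace := by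
    rw [conjFLO, Matrix.trace_mul_comm, ← mul_assoc, Matrix.conjTranspose_kronecker,
      ← Matrix.mul_kronecker_mul, (implements_floUnitary R).conjTranspose_mul_self,
      Matrix.one_kronecker_one, one_mul]
  have := map_twirl (Matrix.traceLinearMap _ ℂ ℂ) ρ
  simpa [h] using this

/-- A vector that is annihilated by the whole integrand is annihilated by the twirl. -/
lemma mulVec_twirl_eq_zero {ρ : Op2 m} {v : Finset (Fin m) × Finset (Fin m) → ℂ}
    (h : ∀ R, conjFLO ρ R *ᵥ v = 0) : twirl ρ *ᵥ v = 0 := by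
  funext p
  have := map_twirl (LinearMap.proj p ∘ₗ (Matrix.mulVecBilin ℂ ℂ).flip v) ρ
  simpa [h] using this

/-- `Λ` is invariant under the two-copy unitaries. -/
lemma commute_Lam {U : Op m} {R : OGroup m} (hU : Implements U R) :
    (U ⊗ₖ U) * Lam m = Lam m * (U ⊗ₖ U) := by
  have hUU : (U ⊗ₖ U)ᴴ * (U ⊗ₖ U) = 1 := by
    rw [Matrix.conjTranspose_kronecker, ← Matrix.mul_kronecker_mul, hU.conjTranspose_mul_self,
      Matrix.one_kronecker_one]
  have hR : (R : Matrix (MIdx m) (MIdx m) ℝ)ᵀ * R = 1 := Matrix.mem_unitaryGroup_iff'.mp R.2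
  have h : (U ⊗ₖ U) * Lam m * (U ⊗ₖ U)ᴴ = Lam m := by
    calc (U ⊗ₖ U) * Lam m * (U ⊗ₖ U)ᴴ
        = ∑ j, (U * majorana j * Uᴴ) ⊗ₖ (U * majorana j * Uᴴ) := by
          simp only [Lam, Finset.mul_sum, Finset.sum_mul, Matrix.conjTranspose_kronecker,
            Matrix.mul_kronecker_mul]
      _ = ∑ j, ∑ i, ∑ k, (((R : Matrix (MIdx m) (MIdx m) ℝ) j i *
            (R : Matrix (MIdx m) (MIdx m) ℝ) j k : ℝ) : ℂ) • (majorana i ⊗ₖ majorana k) := by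
          simp only [hU.2, Complex.ofReal_mul]
          exact Finset.sum_congr rfl fun j _ => cliff_kronecker_cliff _ _
      _ = ∑ i, ∑ k, (((1 : Matrix (MIdx m) (MIdx m) ℝ) i k : ℝ) : ℂ) •
            (majorana i ⊗ₖ majorana k) := by
          rw [Finset.sum_comm]
          refine Finset.sum_congr rfl fun i _ => ?_
          rw [Finset.sum_comm]
          refine Finset.sum_congr rfl fun k _ => ?_
          rw [← Finset.sum_smul, ← hR, Matrix.mul_apply]
          simp
      _ = Lam m := by
          simp [Matrix.one_apply, ite_smul, Lam]
  calc (U ⊗ₖ U) * Lam m = (U ⊗ₖ U) * Lam m * ((U ⊗ₖ U)ᴴ * (U ⊗ₖ U)) := by rw [hUU, mul_one]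
    _ = _ := by rw [← mul_assoc, h]

/-! ### The joint eigenbasis of the operators `c_j ⊗ c_j` and the null space of `Λ` -/

section Action

variable {ι : Type*} [Fintype ι] [DecidableEq ι]

/-- The action of a matrix on Euclidean space. -/
def act (A : Matrix ι ι ℂ) : EuclideanSpace ℂ ι →L[ℂ] EuclideanSpace ℂ ι :=
  Matrix.toEuclideanCLM (𝕜 := ℂ) A

lemma act_mul (A B : Matrix ι ι ℂ) (v : EuclideanSpace ℂ ι) : act (A * B) v = act A (act B v) := by
  simp [act]

lemma act_one (v : EuclideanSpace ℂ ι) : act (1 : Matrix ι ι ℂ) v = v := by simp [act]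

lemma act_zero (v : EuclideanSpace ℂ ι) : act (0 : Matrix ι ι ℂ) v = 0 := by simp [act]

lemma act_add (A B : Matrix ι ι ℂ) (v : EuclideanSpace ℂ ι) :
    act (A + B) v = act A v + act B v := by simp [act]

lemma act_smul (z : ℂ) (A : Matrix ι ι ℂ) (v : EuclideanSpace ℂ ι) :
    act (z • A) v = z • act A v := by simp [act]

lemma act_sum {κ : Type*} (s : Finset κ) (A : κ → Matrix ι ι ℂ) (v : EuclideanSpace ℂ ι) :
    act (∑ k ∈ s, A k) v = ∑ k ∈ s, act (A k) v := by simp [act]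

lemma act_apply (A : Matrix ι ι ℂ) (v : EuclideanSpace ℂ ι) (i : ι) :
    act A v i = ∑ j, A i j * v j := rfl

lemma inner_act_left (A : Matrix ι ι ℂ) (v w : EuclideanSpace ℂ ι) :
    inner ℂ (act A v) w = inner ℂ v (act Aᴴ w) := by
  rw [act, act, ← Matrix.star_eq_conjTranspose, map_star, ContinuousLinearMap.star_eq_adjoint,
    ContinuousLinearMap.adjoint_inner_right]

lemma act_injective_of_mul_eq_one {A B : Matrix ι ι ℂ} (h : A * B = 1)
    {v : EuclideanSpace ℂ ι} (hv : act B v = 0) : v = 0 := by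
  rw [← act_one v, ← h, act_mul, hv, map_zero]

end Action

lemma mem_nullSpace {v : Fock2 m} : v ∈ nullSpace m ↔ act (Lam m) v = 0 := Iff.rfl

/-- The commuting involutions `c_j ⊗ c_j`. -/
def pairOp (j : MIdx m) : Op2 m := majorana j ⊗ₖ majorana j

/-- The parity operator of the two copies together. -/
def parity2 (m : ℕ) : Op2 m := parity m ⊗ₖ parity m

lemma parity2_mul_self : parity2 m * parity2 m = 1 := by
  rw [parity2, ← Matrix.mul_kronecker_mul, parity_mul_self, Matrix.one_kronecker_one]

lemma pairOp_conjTranspose (j : MIdx m) : (pairOp j)ᴴ = pairOp j := by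
  rw [pairOp, Matrix.conjTranspose_kronecker, majorana_conjTranspose]

lemma Lam_conjTranspose : (Lam m)ᴴ = Lam m := by
  rw [Lam, Matrix.conjTranspose_sum]
  exact Finset.sum_congr rfl fun j _ => pairOp_conjTranspose j

/-- The eigenvalue of `c_j ⊗ c_j` that is encoded by the set `S` of negative signs. -/
def eigSign (S : Finset (MIdx m)) (j : MIdx m) : ℂ := if j ∈ S then -1 else 1

/-- `v` is a joint eigenvector of the operators `c_j ⊗ c_j` with signs `eigSign S`, and the total
parity of `v` is `(-1) ^ (m + |S|)`, the value that these signs force. The zero vector is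
allowed. -/
def IsEig (S : Finset (MIdx m)) (v : Fock2 m) : Prop :=
  (∀ j, act (pairOp j) v = eigSign S j • v) ∧
    act (parity2 m) v = ((-1) ^ (m + S.card) : ℂ) • v

lemma annihilation_transpose (k : Fin m) : (annihilation k)ᵀ = (annihilation k)ᴴ := by
  ext s t
  rw [Matrix.transpose_apply, Matrix.conjTranspose_apply, annihilation_apply]
  split_ifs
  · rw [star_jwSign]
  · simp

lemma majorana_mul_transpose (j : MIdx m) :
    majorana j * (majorana j)ᵀ = if j.2 = 1 then -1 else 1 := by
  have h : (majorana j)ᵀ = if j.2 = 1 then -majorana j else majorana j := by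
    have h1 : ((annihilation j.1)ᴴ)ᵀ = annihilation j.1 := by
      rw [← annihilation_transpose, Matrix.transpose_transpose]
    unfold majorana
    rcases (by omega : j.2 = 0 ∨ j.2 = 1) with h2 | h2
    · simp [h2, annihilation_transpose, h1, add_comm]
    · simp [h2, annihilation_transpose, h1, ← smul_neg]
  rw [h]
  split_ifs <;> simp [majorana_mul_self]

/-- The unnormalized maximally entangled vector `∑ s, |s, s⟩`. -/
def entangled (m : ℕ) : Fock2 m := WithLp.toLp 2 fun p => if p.1 = p.2 then 1 else 0

lemma act_kronecker_entangled (A B : Op m) (p : Finset (Fin m) × Finset (Fin m)) :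
    act (A ⊗ₖ B) (entangled m) p = (A * Bᵀ) p.1 p.2 := by
  rw [act_apply, Fintype.sum_prod_type]
  simp [entangled, Matrix.mul_apply]

/-- Since `(A ⊗ B) ∑ s, |s, s⟩ = (A Bᵀ ⊗ 1) ∑ s, |s, s⟩` and `c_jᵀ = ± c_j`, the entangled vector is
a joint eigenvector. -/
lemma isEig_entangled :
    IsEig (Finset.univ.filter fun j : MIdx m => j.2 = 1) (entangled m) := by
  have hcard : (Finset.univ.filter fun j : MIdx m => j.2 = 1).card = m := by
    have : (Finset.univ.filter fun j : MIdx m => j.2 = 1) = Finset.univ ×ˢ {1} := by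
      ext j; rw [Finset.mem_product]; simp
    rw [this, Finset.card_product]; simp
  constructor
  · intro j
    ext p
    rw [pairOp, act_kronecker_entangled, majorana_mul_transpose]
    by_cases hj : j.2 = 1 <;> simp [hj, eigSign, entangled, Matrix.one_apply]
  · ext p
    rw [parity2, act_kronecker_entangled, parity, Matrix.diagonal_transpose, ← parity,
      parity_mul_self, hcard, ← two_mul, pow_mul]
    simp [entangled, Matrix.one_apply]

/-- The operator `(-1)^N c_j ⊗ 1` flips the sign of index `j` and no other one. -/
lemma IsEig.flip {S : Finset (MIdx m)} {v : Fock2 m} (h : IsEig S v) (j : MIdx m) :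
    IsEig (symmDiff S {j}) (act ((parity m * majorana j) ⊗ₖ 1) v) := by
  constructor
  · intro k
    have hk : pairOp k * ((parity m * majorana j) ⊗ₖ 1) =
        (if k = j then -1 else 1 : ℂ) • (((parity m * majorana j) ⊗ₖ 1) * pairOp k) := by
      rw [pairOp, ← Matrix.mul_kronecker_mul, ← Matrix.mul_kronecker_mul, mul_one, one_mul,
        ← Matrix.smul_kronecker]
      congr 1
      have hp : majorana k * parity m = -(parity m * majorana k) := by
        rw [parity_mul_majorana, neg_neg]
      rw [← mul_assoc, hp]
      split_ifs with hkj
      · subst hkj; simp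
      · rw [neg_mul, mul_assoc, majorana_mul_of_ne hkj]; simp [mul_assoc]
    rw [← act_mul, hk, act_smul, act_mul, h.1, map_smul, smul_smul]
    congr 1
    simp only [eigSign, mem_symmDiff_singleton]
    by_cases hkj : k = j <;> by_cases hkS : k ∈ S <;> simp_all
  · have hp : parity2 m * ((parity m * majorana j) ⊗ₖ 1) =
        (-1 : ℂ) • (((parity m * majorana j) ⊗ₖ 1) * parity2 m) := by
      rw [parity2, ← Matrix.mul_kronecker_mul, ← Matrix.mul_kronecker_mul, mul_one, one_mul,
        ← Matrix.smul_kronecker, ← mul_assoc, mul_assoc (parity m) (majorana j)]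
      congr 1
      have hp : majorana j * parity m = -(parity m * majorana j) := by
        rw [parity_mul_majorana, neg_neg]
      rw [hp]; simp [mul_assoc]
    rw [← act_mul, hp, act_smul, act_mul, h.2, map_smul, smul_smul]
    congr 1
    by_cases hj : j ∈ S
    · rw [symmDiff_singleton_of_mem hj, ← Finset.card_erase_add_one hj]; ring
    · rw [symmDiff_singleton_of_notMem hj, Finset.card_insert_of_notMem hj]; ring

lemma exists_isEig (S : Finset (MIdx m)) : ∃ v : Fock2 m, ‖v‖ = 1 ∧ IsEig S v := by
  suffices h : ∃ v : Fock2 m, v ≠ 0 ∧ IsEig S v by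
    obtain ⟨v, hv, h⟩ := h
    refine ⟨((‖v‖ : ℂ)⁻¹) • v, ?_, fun j => ?_, ?_⟩
    · rw [norm_smul]; simp [hv]
    · rw [map_smul, h.1, smul_comm]
    · rw [map_smul, h.2, smul_comm]
  set S₀ := Finset.univ.filter fun j : MIdx m => j.2 = 1 with hS₀
  -- starting from the entangled vector, the signs in `D` are flipped one at a time
  have key (D : Finset (MIdx m)) : ∃ v : Fock2 m, v ≠ 0 ∧ IsEig (symmDiff S₀ D) v := by
    induction D using Finset.induction with
    | empty =>
      refine ⟨entangled m, fun h => ?_, ?_⟩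
      · have : entangled m (∅, ∅) = 0 := by rw [h]; rfl
        simp [entangled] at this
      · rw [← Finset.bot_eq_empty, symmDiff_bot]; exact isEig_entangled
    | insert j D hj ih =>
      obtain ⟨v, hv, h⟩ := ih
      refine ⟨_, fun h0 => hv ?_, symmDiff_singleton_of_notMem hj ▸ (symmDiff_assoc S₀ D {j}) ▸
        h.flip j⟩
      refine act_injective_of_mul_eq_one (A := (majorana j * parity m) ⊗ₖ 1) ?_ h0
      rw [← Matrix.mul_kronecker_mul, mul_assoc, ← mul_assoc (parity m), parity_mul_self, one_mul,
        majorana_mul_self, one_mul, Matrix.one_kronecker_one]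
  have := key (symmDiff S₀ S)
  rwa [symmDiff_symmDiff_cancel_left] at this

lemma inner_eq_zero_of_eigSign_ne {S S' : Finset (MIdx m)} (h : S ≠ S') {v w : Fock2 m}
    (hv : ∀ j, act (pairOp j) v = eigSign S j • v)
    (hw : ∀ j, act (pairOp j) w = eigSign S' j • w) : inner ℂ v w = 0 := by
  obtain ⟨j, hj⟩ : ∃ j, ¬ (j ∈ S ↔ j ∈ S') := by
    by_contra! h'; exact h (Finset.ext h')
  have h1 := inner_act_left (pairOp j) v w
  rw [pairOp_conjTranspose, hv, hw, inner_smul_left, inner_smul_right] at h1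
  by_cases hS : j ∈ S <;> by_cases hS' : j ∈ S' <;> simp [eigSign, hS, hS'] at h1 hj
  · linear_combination (-1 / 2 : ℂ) * h1
  · linear_combination (1 / 2 : ℂ) * h1

/-- The operators `c_j ⊗ c_j` have an orthonormal basis of joint eigenvectors in which every sign
pattern occurs exactly once: all patterns occur, and their number is the dimension. -/
lemma exists_eigenbasis (m : ℕ) :
    ∃ b : OrthonormalBasis (Finset (MIdx m)) ℂ (Fock2 m), ∀ S, IsEig S (b S) := by
  choose v hv1 hv using exists_isEig (m := m)
  have hon : Orthonormal ℂ v :=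
    ⟨hv1, fun S S' h => inner_eq_zero_of_eigSign_ne h (hv S).1 (hv S').1⟩
  have hcard : Fintype.card (Finset (MIdx m)) = Module.finrank ℂ (Fock2 m) := by
    simp [← pow_add, mul_two]
  refine ⟨OrthonormalBasis.mk hon
    (hon.linearIndependent.span_eq_top_of_card_eq_finrank' hcard).ge, fun S => ?_⟩
  rw [OrthonormalBasis.coe_mk]
  exact hv S

/-- The basis of joint eigenvectors of the operators `c_j ⊗ c_j`. -/
def eigBasis (m : ℕ) : OrthonormalBasis (Finset (MIdx m)) ℂ (Fock2 m) :=
  (exists_eigenbasis m).choose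

lemma isEig_eigBasis (S : Finset (MIdx m)) : IsEig S (eigBasis m S) :=
  (exists_eigenbasis m).choose_spec S

/-- The joint eigenspaces of the `c_j ⊗ c_j` are one-dimensional. -/
lemma eq_smul_eigBasis {S : Finset (MIdx m)} {v : Fock2 m}
    (hv : ∀ j, act (pairOp j) v = eigSign S j • v) : ∃ z : ℂ, v = z • eigBasis m S := by
  refine ⟨inner ℂ (eigBasis m S) v, ?_⟩
  conv_lhs => rw [← (eigBasis m).sum_repr' v]
  refine Finset.sum_eq_single S (fun S' _ h => ?_) (by simp)
  rw [inner_eq_zero_of_eigSign_ne h (isEig_eigBasis S').1 hv, zero_smul]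

/-- The eigenvalues of `Λ`. -/
lemma sum_eigSign (S : Finset (MIdx m)) : ∑ j, eigSign S j = 2 * ((m : ℂ) - S.card) := by
  have h : ∀ j, eigSign S j = 1 - 2 * if j ∈ S then 1 else 0 := by
    intro j; unfold eigSign; split_ifs <;> norm_num
  simp only [h, Finset.sum_sub_distrib, ← Finset.mul_sum]
  simp
  ring

lemma act_Lam_eigBasis (S : Finset (MIdx m)) :
    act (Lam m) (eigBasis m S) = (2 * ((m : ℂ) - S.card)) • eigBasis m S := by
  rw [Lam, act_sum, ← sum_eigSign, Finset.sum_smul]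
  exact Finset.sum_congr rfl fun j _ => (isEig_eigBasis S).1 j

lemma eigBasis_mem_nullSpace {S : Finset (MIdx m)} (hS : S.card = m) :
    eigBasis m S ∈ nullSpace m := by
  rw [mem_nullSpace, act_Lam_eigBasis, hS]; simp

lemma inner_eigBasis_eq_zero {S : Finset (MIdx m)} (hS : S.card ≠ m) {v : Fock2 m}
    (hv : v ∈ nullSpace m) : inner ℂ (eigBasis m S) v = 0 := by
  have h := inner_act_left (Lam m) (eigBasis m S) v
  rw [Lam_conjTranspose, mem_nullSpace.mp hv, act_Lam_eigBasis, inner_smul_left,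
    inner_zero_right] at h
  have hne : (m : ℂ) - S.card ≠ 0 := by
    rw [sub_ne_zero]; exact_mod_cast hS.symm
  simpa [-map_mul, hne, map_mul] using h

/-- The null space of `Λ` is even. -/
lemma act_parity2_of_mem_nullSpace {v : Fock2 m} (hv : v ∈ nullSpace m) :
    act (parity2 m) v = v := by
  conv_lhs => rw [← (eigBasis m).sum_repr' v]
  conv_rhs => rw [← (eigBasis m).sum_repr' v]
  rw [map_sum]
  refine Finset.sum_congr rfl fun S _ => ?_
  rw [map_smul]
  by_cases hS : S.card = m
  · rw [(isEig_eigBasis S).2, hS, ← two_mul, pow_mul]; simp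
  · rw [inner_eigBasis_eq_zero hS hv]; simp

/-! ### Irreducibility of the null space and the projector formula -/

/-- The orthogonal matrix that permutes the coordinates by `σ`. -/
def permO (σ : Equiv.Perm (MIdx m)) : OGroup m :=
  ⟨Matrix.of fun j i => if σ j = i then 1 else 0, by
    rw [Matrix.mem_orthogonalGroup_iff]
    ext i j
    simp [Matrix.mul_apply, Matrix.one_apply]⟩

/-- The orthogonal matrix that changes the sign of the coordinate `j`. -/
def flipO (j : MIdx m) : OGroup m :=
  ⟨Matrix.diagonal fun i => if i = j then -1 else 1, by
    rw [Matrix.mem_orthogonalGroup_iff, Matrix.diagonal_transpose, Matrix.diagonal_mul_diagonal,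
      ← Matrix.diagonal_one]
    congr 1
    ext i
    by_cases h : i = j <;> simp [h]⟩

lemma implements_flipO (j : MIdx m) : Implements (parity m * majorana j) (flipO j) := by
  have h := implements_reflection (v := Pi.single j 1) (R := flipO j) (by simp [Pi.single_apply])
    fun i k => by
      change Matrix.diagonal (fun i => if i = j then (-1 : ℝ) else 1) i k = _
      rw [Matrix.diagonal_apply]
      by_cases hik : i = k <;> by_cases hi : i = j <;> by_cases hk : k = j <;>
        simp_all ; norm_num
  have hc : (fun i => ((Pi.single j 1 : MIdx m → ℝ) i : ℂ)) = Pi.single j 1 := by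
    ext i; by_cases hi : i = j <;> simp [hi]
  rwa [hc, cliff_single] at h

/-- Schur's lemma for the null space of `Λ`: an operator on it that commutes with all two-copy
unitaries is a scalar. Sign changes of single coordinates force it to be diagonal in the eigenbasis
of the `c_j ⊗ c_j`, and permutations of the coordinates act transitively on the `m`-element sets
that index the eigenvectors. -/
lemma exists_scalar_of_commute {T : Op2 m} (hl : Lam m * T = 0) (hr : T * Lam m = 0)
    (hT : ∀ (U : Op m) (R : OGroup m), Implements U R → (U ⊗ₖ U) * T = T * (U ⊗ₖ U)) :
    ∃ τ : ℂ, ∀ S, act T (eigBasis m S) = if S.card = m then τ • eigBasis m S else 0 := by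
  have hdiag (S : Finset (MIdx m)) (hS : S.card = m) :
      ∃ z : ℂ, act T (eigBasis m S) = z • eigBasis m S := by
    refine eq_smul_eigBasis fun j => ?_
    have hU : (parity m * majorana j) ⊗ₖ (parity m * majorana j) = parity2 m * pairOp j := by
      rw [Matrix.mul_kronecker_mul, parity2, pairOp]
    have hc := hT _ _ (implements_flipO j)
    rw [hU] at hc
    have hc' : pairOp j * T = parity2 m * (T * (parity2 m * pairOp j)) := by
      rw [← hc, ← mul_assoc, ← mul_assoc, parity2_mul_self, one_mul]
    -- the parity factors act trivially, on both sides of `T`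
    have hnull : act T (eigBasis m S) ∈ nullSpace m := by
      rw [mem_nullSpace, ← act_mul, hl, act_zero]
    rw [← act_mul, hc', act_mul, act_mul, act_mul, (isEig_eigBasis S).1, map_smul,
      act_parity2_of_mem_nullSpace (eigBasis_mem_nullSpace hS), map_smul, map_smul,
      act_parity2_of_mem_nullSpace hnull]
  choose! z hz using hdiag
  have hconst (S S' : Finset (MIdx m)) (hS : S.card = m) (hS' : S'.card = m) : z S = z S' := by
    -- a permutation of the indices that maps `S` to `S'`, and a unitary that implements it
    let e : {x // x ∈ S} ≃ {x // x ∈ S'} := Fintype.equivOfCardEq (by simp [hS, hS'])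
    let σ : Equiv.Perm (MIdx m) := e.extendSubtype
    have hσ (j : MIdx m) : σ j ∈ S' ↔ j ∈ S := by
      refine ⟨fun h => ?_, fun h => e.extendSubtype_mem j h⟩
      by_contra hj
      exact e.extendSubtype_not_mem j hj h
    obtain ⟨U, hU⟩ := exists_implements (permO σ)
    have hUc (j : MIdx m) : U * majorana j = majorana (σ j) * U := by
      have h := hU.2 j
      simp only [permO, Matrix.of_apply] at h
      rw [Finset.sum_eq_single (σ j) (fun i _ hi => by simp [hi.symm]) (by simp)] at h
      simp only [if_true, Complex.ofReal_one, one_smul] at h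
      rw [← h, mul_assoc, hU.conjTranspose_mul_self, mul_one]
    obtain ⟨a, ha⟩ : ∃ a : ℂ, act (U ⊗ₖ U) (eigBasis m S) = a • eigBasis m S' := by
      refine eq_smul_eigBasis fun k => ?_
      obtain ⟨j, rfl⟩ := σ.surjective k
      have : pairOp (σ j) * (U ⊗ₖ U) = (U ⊗ₖ U) * pairOp j := by
        rw [pairOp, pairOp, ← Matrix.mul_kronecker_mul, ← Matrix.mul_kronecker_mul, hUc]
      rw [← act_mul, this, act_mul, (isEig_eigBasis S).1, map_smul]
      simp only [eigSign, hσ]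
    have ha0 : a ≠ 0 := by
      rintro rfl
      rw [zero_smul] at ha
      refine (eigBasis m).orthonormal.ne_zero S
        (act_injective_of_mul_eq_one (A := (U ⊗ₖ U)ᴴ) ?_ ha)
      rw [Matrix.conjTranspose_kronecker, ← Matrix.mul_kronecker_mul, hU.conjTranspose_mul_self,
        Matrix.one_kronecker_one]
    have h1 : act ((U ⊗ₖ U) * T) (eigBasis m S) = act (T * (U ⊗ₖ U)) (eigBasis m S) := by
      rw [hT U _ hU]
    rw [act_mul, act_mul, hz S hS, map_smul, ha, map_smul, hz S' hS', smul_smul, smul_smul,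
      mul_comm] at h1
    exact mul_left_cancel₀ ha0
      (smul_left_injective ℂ ((eigBasis m).orthonormal.ne_zero S') h1)
  obtain ⟨S₀, -, hS₀⟩ := Finset.exists_subset_card_eq
    (s := (Finset.univ : Finset (MIdx m))) (n := m) (by simp; omega)
  refine ⟨z S₀, fun S => ?_⟩
  split_ifs with hS
  · rw [hz S hS, hconst S S₀ hS hS₀]
  · have hne : (2 * ((m : ℂ) - S.card)) ≠ 0 := by
      refine mul_ne_zero two_ne_zero ?_
      rw [sub_ne_zero]; exact_mod_cast Ne.symm hS
    have h0 : act (T * Lam m) (eigBasis m S) = 0 := by rw [hr, act_zero]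
    rw [act_mul, act_Lam_eigBasis, map_smul] at h0
    exact (smul_eq_zero.mp h0).resolve_left hne

/-- The twirl of an operator of trace one that is supported on the null space of `Λ` is the
normalized projector onto that null space. -/
lemma toEuclideanCLM_twirl {ρ : Op2 m} (hl : Lam m * ρ = 0) (hr : ρ * Lam m = 0)
    (htr : ρ.trace = 1) :
    Matrix.toEuclideanCLM (𝕜 := ℂ) (((2 * m).choose m : ℂ) • twirl ρ) =
      (nullSpace m).starProjection := by
  have hlU (R : OGroup m) : Lam m * conjFLO ρ R = 0 := by
    rw [conjFLO, ← mul_assoc, ← mul_assoc, ← commute_Lam (implements_floUnitary R),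
      mul_assoc _ (Lam m) ρ, hl, mul_zero, zero_mul]
  have hrU (R : OGroup m) : conjFLO ρ R * Lam m = 0 := by
    have h := congrArg Matrix.conjTranspose (commute_Lam (implements_floUnitary R))
    rw [Matrix.conjTranspose_mul, Matrix.conjTranspose_mul, Lam_conjTranspose] at h
    rw [conjFLO, mul_assoc, ← h, ← mul_assoc, mul_assoc _ ρ, hr, mul_zero, zero_mul]
  have hlT : Lam m * twirl ρ = 0 := by
    ext p q
    have := mul_twirl_mul_apply (Lam m) 1 ρ p q
    simpa [hlU] using this
  have hrT : twirl ρ * Lam m = 0 := by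
    ext p q
    have := mul_twirl_mul_apply 1 (Lam m) ρ p q
    simpa [hrU] using this
  obtain ⟨τ, hτ⟩ := exists_scalar_of_commute hlT hrT fun U R hU => commute_twirl hU ρ
  have hτ1 : ((2 * m).choose m : ℂ) * τ = 1 := by
    have h1 : LinearMap.trace ℂ (Fock2 m) (act (twirl ρ)).toLinearMap = 1 := by
      rw [act, Matrix.coe_toEuclideanCLM_eq_toEuclideanLin, Matrix.toEuclideanLin,
        Matrix.toLpLin_eq_toLin,
        Matrix.trace_toLin_eq, trace_twirl, htr]
    rw [LinearMap.trace_eq_sum_inner _ (eigBasis m)] at h1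
    have h2 (S : Finset (MIdx m)) : inner ℂ (eigBasis m S)
        ((act (twirl ρ)).toLinearMap (eigBasis m S)) = if S.card = m then τ else 0 := by
      rw [ContinuousLinearMap.coe_coe, hτ]
      split_ifs <;> simp
    simp only [h2] at h1
    rw [← Finset.sum_filter, Finset.sum_const, nsmul_eq_mul] at h1
    rw [← h1]
    congr 2
    rw [← Finset.powerset_univ, ← Finset.powersetCard_eq_filter, Finset.card_powersetCard]
    simp [mul_comm]
  refine ContinuousLinearMap.coe_injective ((eigBasis m).toBasis.ext fun S => ?_)
  rw [OrthonormalBasis.coe_toBasis]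
  change act _ _ = _
  rw [act_smul, hτ]
  split_ifs with hS
  · rw [smul_smul, hτ1, one_smul]
    exact (Submodule.starProjection_eq_self_iff.mpr (eigBasis_mem_nullSpace hS)).symm
  · rw [smul_zero]
    refine ((Submodule.starProjection_apply_eq_zero_iff _).mpr ?_).symm
    rw [Submodule.mem_orthogonal']
    exact fun v hv => inner_eigBasis_eq_zero hS hv

/-! ### Doubled vacua and Gaussian states -/

section Ketbra

lemma ketbra_conjTranspose {ι : Type*} (v : EuclideanSpace ℂ ι) : (ketbra v)ᴴ = ketbra v := by
  ext i j
  simp [ketbra, mul_comm]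

lemma ketbra_mulVec {ι : Type*} [Fintype ι] (v w : EuclideanSpace ℂ ι) :
    ketbra v *ᵥ w = inner ℂ v w • (v : ι → ℂ) := by
  funext i
  rw [PiLp.inner_apply, Matrix.mulVec, dotProduct, Pi.smul_apply, smul_eq_mul, Finset.sum_mul]
  refine Finset.sum_congr rfl fun j _ => ?_
  simp [ketbra]
  ring

lemma trace_ketbra {ι : Type*} [Fintype ι] (v : EuclideanSpace ℂ ι) :
    (ketbra v).trace = (‖v‖ : ℂ) ^ 2 := by
  have h : (ketbra v).trace = inner ℂ v v := by
    rw [PiLp.inner_apply]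
    simp [Matrix.trace, ketbra, Complex.mul_conj']
  rw [h, inner_self_eq_norm_sq_to_K]
  rfl

variable {ι : Type*} [Fintype ι] [DecidableEq ι]

lemma mul_ketbra_apply (A : Matrix ι ι ℂ) (v : EuclideanSpace ℂ ι) (i j : ι) :
    (A * ketbra v) i j = act A v i * star (v j) := by
  simp only [Matrix.mul_apply, ketbra, Matrix.of_apply, act_apply, Finset.sum_mul, mul_assoc]

lemma mul_ketbra_mul_conjTranspose (A : Matrix ι ι ℂ) (v : EuclideanSpace ℂ ι) :
    A * ketbra v * Aᴴ = ketbra (act A v) := by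
  ext i j
  change _ = act A v i * star (act A v j)
  simp only [Matrix.mul_apply (M := A * ketbra v), mul_ketbra_apply, Matrix.conjTranspose_apply]
  rw [act_apply A v j, star_sum, Finset.mul_sum]
  refine Finset.sum_congr rfl fun k _ => ?_
  rw [star_mul']
  ring

end Ketbra

lemma act_kronecker_double (A B : Op m) (ψ : Fock m) (p : Finset (Fin m) × Finset (Fin m)) :
    act (A ⊗ₖ B) (double ψ) p = act A ψ p.1 * act B ψ p.2 := by
  rw [act_apply, act_apply, act_apply, Fintype.sum_prod_type, Finset.sum_mul_sum]
  refine Finset.sum_congr rfl fun i _ => Finset.sum_congr rfl fun j _ => ?_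
  simp only [Matrix.kroneckerMap_apply, double]
  ring

lemma ketbra_double (ψ : Fock m) : ketbra (double ψ) = ketbra ψ ⊗ₖ ketbra ψ := by
  ext p q
  simp [ketbra, double]
  ring

/-- Membership of `|ψ, ψ⟩` in the null space depends only on the projector `|ψ⟩⟨ψ|`. -/
lemma double_mem_nullSpace_iff (ψ : Fock m) :
    double ψ ∈ nullSpace m ↔ Lam m * (ketbra ψ ⊗ₖ ketbra ψ) = 0 := by
  rw [← ketbra_double, mem_nullSpace]
  constructor
  · intro h
    ext p q
    rw [mul_ketbra_apply, h]
    simp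
  · intro h
    by_cases hd : ∃ q, double ψ q ≠ 0
    · obtain ⟨q, hq⟩ := hd
      ext p
      have h1 := mul_ketbra_apply (Lam m) (double ψ) p q
      rw [h, Matrix.zero_apply] at h1
      exact (mul_eq_zero.mp h1.symm).resolve_right (star_ne_zero.mpr hq)
    · push Not at hd
      have : double ψ = 0 := by ext q; exact hd q
      rw [this, map_zero]

lemma toEuclideanCLM_twirl_double {ψ : Fock m} (hψ : ‖ψ‖ = 1) (h : double ψ ∈ nullSpace m) :
    Matrix.toEuclideanCLM (𝕜 := ℂ)
        (((2 * m).choose m : ℂ) • twirl (ketbra (double ψ))) = (nullSpace m).starProjection := by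
  have h0 : Lam m * ketbra (double ψ) = 0 := by
    rw [ketbra_double]; exact (double_mem_nullSpace_iff ψ).mp h
  refine toEuclideanCLM_twirl h0 ?_ ?_
  · have := congrArg Matrix.conjTranspose h0
    rwa [Matrix.conjTranspose_mul, Lam_conjTranspose, ketbra_conjTranspose,
      Matrix.conjTranspose_zero] at this
  · rw [ketbra_double, Matrix.trace_kronecker, trace_ketbra, hψ]
    simp

/-- For any set of annihilation operators, `Λ = 2 ∑ k, (b_k† ⊗ b_k + b_k ⊗ b_k†)`: the coefficient
vectors of the operators `b_k` and `b_k†`, scaled by `√2`, form a unitary matrix. -/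
lemma IsAnnihilationFamily.Lam_eq {b : Fin m → Op m} (hb : IsAnnihilationFamily b) :
    Lam m = (2 : ℂ) • ∑ k, ((b k)ᴴ ⊗ₖ b k + b k ⊗ₖ (b k)ᴴ) := by
  have hB (k : Fin m) : ∃ v, cliff v = b k :=
    (Submodule.mem_span_range_iff_exists_fun ℂ).mp (hb.linear k)
  choose B hB using hB
  have scalar {z w : ℂ} (h : z • (1 : Op m) = w • 1) : z = w := by
    simpa using congrFun (congrFun h ∅) ∅
  have h1 (j k : Fin m) : 2 * ∑ i, B j i * star (B k i) = if j = k then 1 else 0 := by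
    have := hb.anticomm_adjoint j k
    rw [← hB, ← hB, cliff_conjTranspose, cliff_anticomm] at this
    refine scalar (this.trans ?_)
    split_ifs <;> simp
  have h2 (j k : Fin m) : 2 * ∑ i, B j i * B k i = 0 := by
    have := hb.anticomm j k
    rw [← hB, ← hB, cliff_anticomm] at this
    exact scalar (this.trans (zero_smul _ _).symm)
  -- rows: the coefficient vectors of `b_k` and of `b_k†`; the relations say `M (2 M†) = 1`,
  -- and `(2 M†) M = 1` is the claim
  let M : Matrix (MIdx m) (MIdx m) ℂ := Matrix.of fun q i =>
    if q.2 = 0 then B q.1 i else star (B q.1 i)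
  have hM : M * ((2 : ℂ) • Mᴴ) = 1 := by
    ext q r
    obtain ⟨j, e⟩ := q
    obtain ⟨k, f⟩ := r
    rw [Matrix.mul_smul, Matrix.smul_apply, Matrix.mul_apply, Matrix.one_apply]
    fin_cases e <;> fin_cases f
    · simpa [M] using h1 j k
    · simpa [M] using h2 j k
    · simpa [M] using congrArg star (h2 j k)
    · simpa [M, apply_ite star] using congrArg star (h1 j k)
  have hM' : ((2 : ℂ) • Mᴴ) * M = 1 := mul_eq_one_comm.mp hM
  have hsum (i l : MIdx m) : (2 : ℂ) * ∑ k, (star (B k i) * B k l + B k i * star (B k l)) =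
      if i = l then 1 else 0 := by
    rw [← Matrix.one_apply, ← hM', Matrix.smul_mul, Matrix.smul_apply, Matrix.mul_apply,
      Fintype.sum_prod_type]
    simp [M]
  calc Lam m = ∑ i, ∑ l, (if i = l then (1 : ℂ) else 0) • (majorana i ⊗ₖ majorana l) := by
        simp [Lam]
    _ = _ := by
        simp only [← hsum, ← hB, cliff_conjTranspose, cliff_kronecker_cliff,
          ← Finset.sum_add_distrib, ← add_smul]
        symm
        rw [Finset.sum_comm, Finset.smul_sum]
        refine Finset.sum_congr rfl fun i _ => ?_
        rw [Finset.sum_comm, Finset.smul_sum]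
        refine Finset.sum_congr rfl fun l _ => ?_
        rw [← Finset.sum_smul, smul_smul]

lemma double_vacuum_mem_nullSpace {b : Fin m → Op m} {Ω : Fock m} (hb : IsAnnihilationFamily b)
    (hΩ : IsVacuum b Ω) : double Ω ∈ nullSpace m := by
  have h (k : Fin m) : act (b k) Ω = 0 := hΩ.2 k
  rw [mem_nullSpace, hb.Lam_eq, act_smul, act_sum]
  refine (smul_eq_zero_of_right _ (Finset.sum_eq_zero fun k _ => ?_))
  ext p
  rw [act_add, PiLp.add_apply, act_kronecker_double, act_kronecker_double, h]
  simp

/-- The occupation-number state `|s⟩`. -/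
def basisState (s : Finset (Fin m)) : Fock m := EuclideanSpace.single s 1

lemma norm_basisState (s : Finset (Fin m)) : ‖basisState s‖ = 1 := by simp [basisState]

lemma double_basisState_mem_nullSpace (s : Finset (Fin m)) :
    double (basisState s) ∈ nullSpace m := by
  have h (j : MIdx m) (t : Finset (Fin m)) :
      act (majorana j) (basisState s) t = majorana j t s := by
    rw [act_apply]; simp [basisState]
  rw [mem_nullSpace, Lam, act_sum]
  ext p
  rw [WithLp.ofLp_sum, Finset.sum_apply, Fintype.sum_prod_type]
  refine Finset.sum_eq_zero fun k _ => ?_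
  rw [Fin.sum_univ_two, act_kronecker_double, act_kronecker_double, h, h, h, h]
  simp only [majorana_apply, phase]
  split_ifs <;> simp_all <;> linear_combination jwSign k s * jwSign k s * Complex.I_sq

lemma ketbra_basisState (s : Finset (Fin m)) :
    ketbra (basisState s) = Matrix.diagonal fun t => if t = s then 1 else 0 := by
  ext t u
  rw [Matrix.diagonal_apply]
  by_cases ht : t = s <;> by_cases hu : u = s <;> simp_all [ketbra, basisState, eq_comm]

lemma I_smul_majorana_mul (k : Fin m) :
    Complex.I • (majorana (k, 0) * majorana (k, 1)) =
      Matrix.diagonal fun t => if k ∈ t then 1 else -1 := by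
  ext s t
  rw [Matrix.smul_apply, majorana_mul_apply, symmDiff_singleton_twice, Matrix.diagonal_apply]
  have hs := jwSign_mul_self k t
  by_cases hst : s = t
  · subst hst
    by_cases hk : k ∈ s <;> simp [phase, jwSign_symmDiff, hk]
    · linear_combination -hs * Complex.I ^ 2 - Complex.I_sq
    · linear_combination hs * Complex.I ^ 2 + Complex.I_sq
  · simp [hst]

/-- The projector `2⁻ᵐ ∏ k, (I + i λ_k c_{2k-1} c_{2k})` is the one onto the occupation-number state
in which the modes with `λ_k = 1` are occupied. -/
lemma gaussian_standard {lam : Fin m → ℝ} (h : ∀ k, lam k = 1 ∨ lam k = -1) :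
    (1 / 2 ^ m : ℂ) • (List.ofFn fun k : Fin m => (1 : Op m) + (Complex.I * (lam k : ℂ)) •
      (majorana (k, 0) * majorana (k, 1))).prod =
      ketbra (basisState (Finset.univ.filter fun k => lam k = 1)) := by
  let f (k : Fin m) : Finset (Fin m) → ℂ := fun t => 1 + lam k * if k ∈ t then 1 else -1
  have hf (k : Fin m) : (1 : Op m) + (Complex.I * (lam k : ℂ)) •
      (majorana (k, 0) * majorana (k, 1)) = Matrix.diagonalRingHom _ ℂ (f k) := by
    rw [mul_comm, mul_smul, I_smul_majorana_mul, ← Matrix.diagonal_one, ← Matrix.diagonal_smul,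
      Matrix.diagonal_add]
    rfl
  have hprod : (List.ofFn fun k : Fin m => Matrix.diagonalRingHom _ ℂ (f k)).prod =
      Matrix.diagonalRingHom _ ℂ (∏ k, f k) := by
    rw [← List.prod_ofFn, map_list_prod, List.map_ofFn]
    rfl
  simp only [hf]
  rw [hprod, ketbra_basisState]
  change (1 / 2 ^ m : ℂ) • Matrix.diagonal (∏ k, f k) = _
  rw [← Matrix.diagonal_smul]
  congr 1
  ext t
  rw [Pi.smul_apply, Finset.prod_apply, smul_eq_mul]
  split_ifs with ht
  · have : ∀ k, f k t = 2 := by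
      intro k
      rcases h k with hk | hk <;> simp [f, ht, hk] <;> norm_num
    simp [this]
  · obtain ⟨k, hk⟩ : ∃ k, ¬ (k ∈ t ↔ lam k = 1) := by
      by_contra! h'; exact ht (Finset.ext fun k => by simp [h' k])
    rw [Finset.prod_eq_zero (Finset.mem_univ k), mul_zero]
    rcases h k with hk' | hk' <;> by_cases hkt : k ∈ t <;> simp [f, hk', hkt] at hk ⊢
    norm_num at hk

lemma conj_list_prod {U : Op m} {R : OGroup m} (hU : Implements U R) (l : List (Op m)) :
    U * l.prod * Uᴴ = (l.map fun A => U * A * Uᴴ).prod := by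
  induction l with
  | nil => simp [hU.mul_conjTranspose_self]
  | cons A l ih =>
    rw [List.map_cons, List.prod_cons, List.prod_cons, ← ih]
    calc U * (A * l.prod) * Uᴴ = U * A * 1 * l.prod * Uᴴ := by simp only [mul_assoc, one_mul]
      _ = _ := by rw [← hU.conjTranspose_mul_self]; simp only [mul_assoc]

/-- The Gaussian projectors are the images of the occupation-number projectors under the unitaries
that implement orthogonal transformations. -/
lemma gaussian_eq_ketbra {U : Op m} {R : OGroup m} (hU : Implements U R⁻¹) {lam : Fin m → ℝ}
    (h : ∀ k, lam k = 1 ∨ lam k = -1) :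
    (1 / 2 ^ m : ℂ) • (List.ofFn fun k : Fin m => (1 : Op m) + (Complex.I * (lam k : ℂ)) •
      ((∑ i, ((R : Matrix (MIdx m) (MIdx m) ℝ) i (k, 0) : ℂ) • majorana i) *
        (∑ i, ((R : Matrix (MIdx m) (MIdx m) ℝ) i (k, 1) : ℂ) • majorana i))).prod =
      ketbra (act U (basisState (Finset.univ.filter fun k => lam k = 1))) := by
  rw [← mul_ketbra_mul_conjTranspose, ← gaussian_standard h, mul_smul_comm, smul_mul_assoc,
    conj_list_prod hU, List.map_ofFn]
  congr 3
  funext k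
  have hc (j : MIdx m) : ∑ i, ((R : Matrix (MIdx m) (MIdx m) ℝ) i j : ℂ) • majorana i =
      U * majorana j * Uᴴ := by
    rw [hU.2]; rfl
  rw [hc, hc, Function.comp_apply, mul_add, add_mul, mul_one, hU.mul_conjTranspose_self,
    mul_smul_comm, smul_mul_assoc]
  congr 2
  calc U * majorana (k, 0) * Uᴴ * (U * majorana (k, 1) * Uᴴ)
      = U * majorana (k, 0) * (Uᴴ * U) * majorana (k, 1) * Uᴴ := by simp only [mul_assoc]
    _ = _ := by rw [hU.conjTranspose_mul_self, mul_one, mul_assoc U]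

lemma IsPureGaussian.double_mem_nullSpace {ψ : Fock m} (h : IsPureGaussian ψ) :
    double ψ ∈ nullSpace m := by
  obtain ⟨R, hR, lam, hlam, hψ⟩ := h
  let R' : OGroup m := ⟨R, (Matrix.mem_specialOrthogonalGroup_iff.mp hR).1⟩
  obtain ⟨U, hU⟩ := exists_implements R'⁻¹
  have key := gaussian_eq_ketbra hU hlam
  rw [double_mem_nullSpace_iff, hψ]
  change Lam m * (_ ⊗ₖ _) = 0
  rw [key, ← mul_ketbra_mul_conjTranspose, Matrix.mul_kronecker_mul, Matrix.mul_kronecker_mul,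
    ← mul_assoc, ← mul_assoc, ← commute_Lam hU, mul_assoc (U ⊗ₖ U),
    (double_mem_nullSpace_iff _).mp (double_basisState_mem_nullSpace _), mul_zero, zero_mul]

/-- The images of the Fock vacuum are pure Gaussian states. For an orthogonal matrix of determinant
`-1`, one coordinate and the corresponding sign `λ_k` are flipped. -/
lemma isPureGaussian_act {U : Op m} {R : OGroup m} (hU : Implements U R) :
    IsPureGaussian (act U (basisState ∅)) := by
  obtain ⟨Q, rfl⟩ : ∃ Q : OGroup m, R = Q⁻¹ := ⟨R⁻¹, (inv_inv R).symm⟩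
  -- all `λ_k = -1`: the projector onto the Fock vacuum
  have hlam0 : ∀ k : Fin m, (fun _ => (-1 : ℝ)) k = 1 ∨ (fun _ => (-1 : ℝ)) k = -1 := by simp
  have key := gaussian_eq_ketbra hU hlam0
  have hs : (Finset.univ.filter fun _ : Fin m => (-1 : ℝ) = 1) = ∅ := by
    norm_num
  rw [hs] at key
  have hQ : (Q : Matrix (MIdx m) (MIdx m) ℝ) * (Q : Matrix (MIdx m) (MIdx m) ℝ)ᵀ = 1 :=
    (Matrix.mem_orthogonalGroup_iff _ _).mp Q.2
  have hdet := congrArg Matrix.det hQ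
  rw [Matrix.det_mul, Matrix.det_transpose, Matrix.det_one, mul_self_eq_one_iff] at hdet
  rcases hdet with hdet | hdet
  · exact ⟨Q, Matrix.mem_specialOrthogonalGroup_iff.mpr ⟨Q.2, hdet⟩, _, hlam0, key.symm⟩
  · obtain ⟨k₀⟩ : Nonempty (Fin m) := by
      by_contra hm
      rw [not_nonempty_iff] at hm
      rw [Matrix.det_isEmpty] at hdet
      norm_num at hdet
    let d : MIdx m → ℝ := fun i => if i = (k₀, 0) then -1 else 1
    have hval : ((Q * flipO (k₀, 0) : OGroup m) : Matrix (MIdx m) (MIdx m) ℝ) =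
        (Q : Matrix (MIdx m) (MIdx m) ℝ) * Matrix.diagonal d := rfl
    refine ⟨(Q * flipO (k₀, 0) : OGroup m), Matrix.mem_specialOrthogonalGroup_iff.mpr
      ⟨(Q * flipO (k₀, 0)).2, ?_⟩, fun k => if k = k₀ then 1 else -1, fun k => ?_, ?_⟩
    · rw [hval, Matrix.det_mul, hdet, Matrix.det_diagonal]
      simp [d]
    · by_cases hk : k = k₀ <;> simp [hk]
    · rw [← key]
      congr 3
      funext k
      simp only [hval, Matrix.mul_diagonal]
      by_cases hk : k = k₀ <;> simp [hk, d]

/-- The projector formula shows that the null space contains no vector orthogonal to all the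
doubled Gaussian states. -/
lemma span_double_gaussian :
    Submodule.span ℂ {v : Fock2 m | ∃ ψ : Fock m, IsPureGaussian ψ ∧ v = double ψ} =
      nullSpace m := by
  set W := Submodule.span ℂ {v : Fock2 m | ∃ ψ : Fock m, IsPureGaussian ψ ∧ v = double ψ} with hW
  have hle : W ≤ nullSpace m := by
    rw [hW, Submodule.span_le]
    rintro _ ⟨ψ, hψ, rfl⟩
    exact hψ.double_mem_nullSpace
  have hbot : Wᗮ ⊓ nullSpace m = ⊥ := by
    rw [eq_bot_iff]
    rintro u ⟨huW, hu⟩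
    have hz : twirl (ketbra (double (basisState (∅ : Finset (Fin m))))) *ᵥ u = 0 := by
      refine mulVec_twirl_eq_zero fun R => ?_
      have hd : act (floUnitary R ⊗ₖ floUnitary R) (double (basisState ∅)) =
          double (act (floUnitary R) (basisState ∅)) := by
        ext p; rw [act_kronecker_double]; rfl
      rw [conjFLO, mul_ketbra_mul_conjTranspose, hd, ketbra_mulVec,
        (Submodule.mem_orthogonal _ _).mp huW _
          (Submodule.subset_span ⟨_, isPureGaussian_act (implements_floUnitary R), rfl⟩), zero_smul]
    have hp := congrArg (fun T : Fock2 m →L[ℂ] Fock2 m => T u)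
      (toEuclideanCLM_twirl_double (norm_basisState ∅) (double_basisState_mem_nullSpace (m := m) ∅))
    simp only [Submodule.starProjection_eq_self_iff.mpr hu] at hp
    rw [Submodule.mem_bot, ← hp]
    ext p
    rw [Matrix.ofLp_toEuclideanCLM, Matrix.smul_mulVec, hz]
    simp
  have h := Submodule.sup_orthogonal_inf_of_hasOrthogonalProjection hle
  rwa [hbot, sup_bot_eq] at h

lemma span_double_gaussian_le_symmetricSubspace :
    Submodule.span ℂ {v : Fock2 m | ∃ ψ : Fock m, IsPureGaussian ψ ∧ v = double ψ} ≤
      symmetricSubspace m := by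
  rw [Submodule.span_le]
  rintro _ ⟨ψ, -, rfl⟩ s t
  exact mul_comm _ _

end Fermion

end

theorem theorem3 (m : ℕ) :
    -- the twirl is well defined: `U` exists, is unique up to a phase, and the integral converges
    (∀ R : Fermion.OGroup m, ∃ U : Fermion.Op m, Fermion.Implements U R) ∧
    (∀ (R : Fermion.OGroup m) (U V : Fermion.Op m),
      Fermion.Implements U R → Fermion.Implements V R → ∃ z : ℂ, ‖z‖ = 1 ∧ V = z • U) ∧
    (∀ (ρ : Fermion.Op2 m) (p q : Finset (Fin m) × Finset (Fin m)),
      MeasureTheory.Integrable (fun R => Fermion.conjFLO ρ R p q) (Fermion.haarO m)) ∧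
    -- the projector onto the null space, for the vacuum of any set of annihilation operators
    (∀ (b : Fin m → Fermion.Op m) (Ω : Fermion.Fock m),
      Fermion.IsAnnihilationFamily b → Fermion.IsVacuum b Ω →
      Matrix.toEuclideanCLM (𝕜 := ℂ)
          (((2 * m).choose m : ℂ) • Fermion.twirl (Fermion.ketbra (Fermion.double Ω))) =
        (Fermion.nullSpace m).starProjection) ∧
    -- the null space is spanned by the doubled pure Gaussian states
    Submodule.span ℂ {v : Fermion.Fock2 m |
        ∃ ψ : Fermion.Fock m, Fermion.IsPureGaussian ψ ∧ v = Fermion.double ψ} =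
      Fermion.nullSpace m ∧
    -- it lies inside the symmetric subspace
    Fermion.nullSpace m ≤ Fermion.symmetricSubspace m := by
  refine ⟨Fermion.exists_implements, fun R U V hU hV => hU.unique hV, Fermion.integrable_conjFLO,
    fun b Ω hb hΩ => Fermion.toEuclideanCLM_twirl_double hΩ.1
      (Fermion.double_vacuum_mem_nullSpace hb hΩ), Fermion.span_double_gaussian, ?_⟩
  rw [← Fermion.span_double_gaussian]
  exact Fermion.span_double_gaussian_le_symmetricSubspace
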